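/- Let $G$ be a group and $H\le G$ a countable subgroup of finite index $n=[G:H]$, and let $G$ act freely and continuously on a compact metrizable space $X$ (with a fixed compatible metric). If the restricted action $H\curvearrowright X$ is almost finite, then the action $G\curvearrowright X$ is almost finite; moreover, $G\curvearrowright X$ has the small boundary property and $n(n+1)$-comparison. Here, for an action of a group $\Gamma$ on $X$: * For finite $K,F\subseteq\Gamma$ let $\partial_KF=\{t\in\Gamma: Kt\cap F\ne\emptyset\text{ and }Kt\cap(\Gamma\setminus F)\neq\emptyset\}$; $F$ is $(K,\delta)$-invariant if $|\partial_KF|\le\delta|F|$. An open castle is a finite family $\{(S_i,V_i)\}_{i\in I}$ of finite sets $S_i\subseteq\Gamma$ (shapes) and open sets $V_i\subseteq X$ such that, for each $i$, the levels $sV_i$, $s\in S_i$, are pairwise disjoint, and the sets $S_iV_i$, $i\in I$, are pairwise disjoint. * $A\prec B$ means that for every closed $C\subseteq A$ there are finitely many open sets $U_1,\dots,U_k$ covering $C$ and $s_1,\dots,s_k\in\Gamma$ such that the sets $s_jU_j$ are pairwise disjoint and contained in $B$. For an integer $m\ge0$, $A\prec_mB$ means that for every closed $C\subseteq A$ there are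 finitely many open sets $U_1,\dots,U_k$ covering $C$, elements $s_1,\dots,s_k\in\Gamma$, and a partition of $\{1,\dots,k\}$ into $m+1$ (possibly empty) classes, such that all $s_jU_j$ are contained in $B$ and, within each class, they are pairwise disjoint. * The action is almost finite if for all integers $N\ge1$, finite $K\subseteq\Gamma$ and $\delta>0$ there are an open castle $\{(S_i,V_i)\}_{i\in I}$ with $(K,\delta)$-invariant shapes and levels of diameter less than $\delta$, and sets $S_i'\subseteq S_i$ with $|S_i'|\le|S_i|/N$, such that $X\setminus\bigsqcup_iS_iV_i\prec\bigsqcup_iS_i'V_i$. * The action has the small boundary property if $X$ has a basis of open sets $U$ with $\overline D_\Gamma(\partial U)=0$, where $\overline D_\Gamma(A)=\inf_F\sup_{x\in X}\frac1{|F|}\sum_{s\in F}1_A(sx)$, with $F$ ranging over the nonempty finite subsets of $\Gamma$. * The action has $m$-comparison if $A\prec_mB$ for all nonempty open $A,B\subseteq X$ such that $\mu(A)<\mu(B)$ for every $\Gamma$-invariant Borel probability measure $\mu$ on $X$. -/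

import Mathlib

open scoped Pointwise

noncomputable section

namespace Dyn

/-- The `K`-boundary `∂_K F = {t : K t ∩ F ≠ ∅ and K t ∩ (G \ F) ≠ ∅}`. -/
def kBoundary {G : Type*} [Group G] (K F : Finset G) : Set G :=
  {t | (∃ k ∈ K, k * t ∈ F) ∧ (∃ k ∈ K, k * t ∉ F)}

/-- The boundary of a finite set is finite, so that its `Set.ncard` is its true cardinality. -/
theorem kBoundary_finite {G : Type*} [Group G] (K F : Finset G) : (kBoundary K F).Finite := by
  refine ((K.finite_toSet.inv).mul F.finite_toSet).subset ?_
  rintro t ⟨⟨k, hk, hkt⟩, -⟩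
  exact Set.mem_mul.2 ⟨k⁻¹, by simpa using hk, k * t, hkt, by group⟩

/-- `F` is (left) `(K, δ)`-invariant: `|∂_K F| ≤ δ |F|`. -/
def IsInvariantShape {G : Type*} [Group G] (K : Finset G) (δ : ℝ) (F : Finset G) : Prop :=
  ((kBoundary K F).ncard : ℝ) ≤ δ * (F.card : ℝ)

section Action

variable {G X : Type*} [Group G] [MulAction G X]

/-- `(S, V)` is a tower: the levels `s V`, `s ∈ S`, are pairwise disjoint. -/
def IsTower (S : Finset G) (V : Set X) : Prop :=
  (S : Set G).PairwiseDisjoint (fun s => s • V)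

/-- The set `S V = ⋃ s ∈ S, s V`. -/
def towerFootprint (S : Finset G) (V : Set X) : Set X :=
  ⋃ s ∈ S, s • V

/-- A finite family of towers with pairwise disjoint footprints. -/
structure IsCastle {k : ℕ} (S : Fin k → Finset G) (V : Fin k → Set X) : Prop where
  tower : ∀ i, IsTower (S i) (V i)
  disjoint : Pairwise fun i j =>
    Disjoint (towerFootprint (S i) (V i)) (towerFootprint (S j) (V j))

/-- The union `⋃ i, S i V i`. -/
def castleFootprint {k : ℕ} (S : Fin k → Finset G) (V : Fin k → Set X) : Set X :=
  ⋃ i, towerFootprint (S i) (V i)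

/-- A castle is open if all bases are open. -/
structure IsOpenCastle [TopologicalSpace X] {k : ℕ} (S : Fin k → Finset G) (V : Fin k → Set X) :
    Prop where
  castle : IsCastle S V
  isOpen : ∀ i, IsOpen (V i)

variable (G)

/-- Subequivalence `A ≺ B` for the action of `G`. -/
def Subequiv [TopologicalSpace X] (A B : Set X) : Prop :=
  ∀ C : Set X, IsClosed C → C ⊆ A →
    ∃ (n : ℕ) (U : Fin n → Set X) (s : Fin n → G),
      (∀ i, IsOpen (U i)) ∧ C ⊆ ⋃ i, U i ∧
      (Pairwise fun i j => Disjoint (s i • U i) (s j • U j)) ∧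
      ∀ i, s i • U i ⊆ B

/-- `A ≺_m B`: as subequivalence, but the open sets are divided into `m + 1` classes
(`c i` is the class of `U i`) and the translates have to be disjoint only within each class. -/
def MSubequiv [TopologicalSpace X] (m : ℕ) (A B : Set X) : Prop :=
  ∀ C : Set X, IsClosed C → C ⊆ A →
    ∃ (n : ℕ) (U : Fin n → Set X) (s : Fin n → G) (c : Fin n → Fin (m + 1)),
      (∀ i, IsOpen (U i)) ∧ C ⊆ ⋃ i, U i ∧
      (∀ i j, i ≠ j → c i = c j → Disjoint (s i • U i) (s j • U j)) ∧
      ∀ i, s i • U i ⊆ B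

/-- The upper density `inf_F sup_x |F|⁻¹ ∑_{s ∈ F} 1_A (s x)`, with `F` ranging over the nonempty
finite subsets of `G`. -/
def upperDensity (A : Set X) : ℝ :=
  ⨅ F : {F : Finset G // F.Nonempty}, ⨆ x : X,
    (∑ s ∈ F.1, A.indicator (fun _ => (1 : ℝ)) (s • x)) / (F.1.card : ℝ)

variable (X)

/-- The action is almost finite. -/
def AlmostFinite [MetricSpace X] : Prop :=
  ∀ (n : ℕ) (K : Finset G) (δ : ℝ), 0 < n → 0 < δ →
    ∃ (k : ℕ) (S : Fin k → Finset G) (V : Fin k → Set X),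
      IsOpenCastle S V ∧
      (∀ i, IsInvariantShape K δ (S i)) ∧
      (∀ i, ∀ s ∈ S i, Metric.diam (s • V i) < δ) ∧
      ∃ S' : Fin k → Finset G,
        (∀ i, S' i ⊆ S i) ∧
        (∀ i, ((S' i).card : ℝ) ≤ ((S i).card : ℝ) / (n : ℝ)) ∧
        Subequiv G (castleFootprint S V)ᶜ (castleFootprint S' V)

/-- Small boundary property: there is a basis of open sets whose boundaries have upper density
zero. -/
def SmallBoundaryProperty [TopologicalSpace X] : Prop :=
  ∃ 𝓑 : Set (Set X), TopologicalSpace.IsTopologicalBasis 𝓑 ∧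
    ∀ U ∈ 𝓑, upperDensity G (frontier U) = 0

/-- `m`-comparison: `A ≺_m B` for all nonempty open `A`, `B` such that `μ A < μ B` for every
`G`-invariant Borel probability measure `μ`. -/
def HasMComparison [TopologicalSpace X] [MeasurableSpace X] [BorelSpace X] (m : ℕ) : Prop :=
  ∀ A B : Set X, IsOpen A → IsOpen B → A.Nonempty → B.Nonempty →
    (∀ μ : MeasureTheory.Measure X, MeasureTheory.IsProbabilityMeasure μ →
      MeasureTheory.SMulInvariantMeasure G X μ → μ A < μ B) →
    MSubequiv G m A B

end Action

end Dyn

end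

noncomputable section

namespace Dyn

open MeasureTheory Filter Topology
open scoped Pointwise ENNReal

/-! ### Invariant shapes: counting exits and translating sums. -/

section Invariance

variable {Γ : Type*} [Group Γ]

/-! Write n for the index and T for the set of coset representatives `q.out`, so that every element
of G is uniquely t h with t in T and h in H. If S is a sufficiently invariant subset of H, then T S
(`liftShape S`) is as invariant in G as required. An H-castle with shapes S_i cannot simply be
replaced by one with shapes T S_i, because the enlarged towers of different indices overlap. Two
H-castles are therefore combined: a fine one (P_j, A_j), and a coarse one (S_i, V_i), far more
invariant, whose bases are cut so small that freeness makes each T S_i V_i a tower. A lifted fine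
tile T P_j z is kept when it lies inside some coarse region T S_i x and avoids the closures of all
regions of smaller index. The kept tiles form an open G-castle; the lost points lie near boundaries
of coarse regions or in translates of the two remainders, so they have small measure for every
G-invariant measure (`AlmostFinite.exists_castle_of_finiteIndex`).

It remains to absorb the remainder R into a small part of the castle. Almost finiteness of H gives
comparison for H (`AlmostFinite.subequiv`), a consequence of weak-* compactness in the form of
`exists_uniform_frequency_bound`. Averaging an H-invariant measure over the cosets
(`exists_average`) shows that R is H-subequivalent to the union of the coset translates of a small
part B of the castle. Translating back by T makes the n translates overlap on B, so each level of B
is given n distinct levels of its tower as targets (`Subequiv.of_coset_translates`).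

Once G is almost finite, the other two claims hold for any almost finite action: comparison by
matching levels of towers, and the small boundary property by squeezing frontiers into
neighbourhoods of remainders of castles. In particular m-comparison holds for every m, not only for
n(n+1). -/

theorem kBoundary_mono {K K' : Finset Γ} (hK : K ⊆ K') (F : Finset Γ) :
    kBoundary K F ⊆ kBoundary K' F := by
  rintro t ⟨⟨k, hk, h⟩, ⟨l, hl, h'⟩⟩
  exact ⟨⟨k, hK hk, h⟩, ⟨l, hK hl, h'⟩⟩

theorem IsInvariantShape.mono {K K' F : Finset Γ} {δ δ' : ℝ} (h : IsInvariantShape K' δ' F)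
    (hK : K ⊆ K') (hδ : δ' ≤ δ) : IsInvariantShape K δ F := by
  have h1 : ((kBoundary K F).ncard : ℝ) ≤ (kBoundary K' F).ncard := by
    exact_mod_cast Set.ncard_le_ncard (kBoundary_mono hK F) (kBoundary_finite K' F)
  exact h1.trans (h.trans (by gcongr))

theorem card_filter_exit_le [DecidableEq Γ] {K F : Finset Γ} {g : Γ} (h1 : (1 : Γ) ∈ K)
    (hg : g ∈ K) : (F.filter fun s => g * s ∉ F).card ≤ (kBoundary K F).ncard := by
  rw [← Set.ncard_coe_finset]
  refine Set.ncard_le_ncard ?_ (kBoundary_finite K F)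
  intro s hs
  simp only [Finset.coe_filter, Set.mem_ofPred_eq] at hs
  exact ⟨⟨1, h1, by simpa using hs.1⟩, ⟨g, hg, hs.2⟩⟩

/-- A nonempty shape that is nearly invariant under `K` is at least as large as `K`. -/
theorem IsInvariantShape.card_le {K F : Finset Γ} {δ : ℝ} (h : IsInvariantShape K δ F)
    (hδ : δ < 1) (hF : F.Nonempty) (h1 : (1 : Γ) ∈ K) : K.card ≤ F.card := by
  classical
  have hlt : (kBoundary K F).ncard < F.card := by
    have hc : (0 : ℝ) < F.card := by exact_mod_cast hF.card_pos
    have : ((kBoundary K F).ncard : ℝ) < F.card := h.trans_lt (by nlinarith)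
    exact_mod_cast this
  -- The boundary is smaller than F, so some s in F is off it; as 1 ∈ K makes K s meet F, all of K s
  -- lies in F.
  obtain ⟨s, hs, hsn⟩ : ∃ s ∈ F, s ∉ kBoundary K F := by
    by_contra! hcon
    have := Set.ncard_le_ncard (s := (F : Set Γ)) (t := kBoundary K F) hcon (kBoundary_finite K F)
    rw [Set.ncard_coe_finset] at this
    omega
  refine Finset.card_le_card_of_injOn (fun k => k * s) ?_ ?_
  · intro k hk
    by_contra hcon
    exact hsn ⟨⟨1, h1, by simpa using hs⟩, ⟨k, hk, hcon⟩⟩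
  · intro a _ b _ hab
    exact mul_right_cancel hab

/-- The terms over gF ∩ F cancel, and gF \ F and F \ gF have the same size, namely the number of
elements of F that g moves out of F. -/
theorem abs_sum_translate_sub_le [DecidableEq Γ] (F : Finset Γ) (g : Γ) (φ : Γ → ℝ) {b : ℝ}
    (hφ : ∀ t, |φ t| ≤ b) :
    |∑ s ∈ F, φ (g * s) - ∑ s ∈ F, φ s| ≤ 2 * b * (F.filter fun s => g * s ∉ F).card := by
  set F' : Finset Γ := F.map (mulLeftEmbedding g) with hF'
  have hsum : ∑ s ∈ F, φ (g * s) = ∑ s ∈ F', φ s := by simp [hF']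
  have hcard : F'.card = F.card := by simp [hF']
  have hc1 : (F' \ F).card = (F.filter fun s => g * s ∉ F).card := by
    have : F' \ F = (F.filter fun s => g * s ∉ F).map (mulLeftEmbedding g) := by
      ext t
      simp only [hF', Finset.mem_sdiff, Finset.mem_map, mulLeftEmbedding_apply, Finset.mem_filter]
      constructor
      · rintro ⟨⟨s, hs, rfl⟩, h⟩
        exact ⟨s, ⟨hs, h⟩, rfl⟩
      · rintro ⟨s, ⟨hs, h⟩, rfl⟩
        exact ⟨⟨s, hs, rfl⟩, h⟩
    rw [this, Finset.card_map]
  have hc2 : (F \ F').card = (F' \ F).card := Finset.card_sdiff_comm hcard.symm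
  have hb : ∀ A : Finset Γ, |∑ s ∈ A, φ s| ≤ A.card * b := fun A => by
    refine (Finset.abs_sum_le_sum_abs _ _).trans ?_
    simpa using Finset.sum_le_card_nsmul A (fun s => |φ s|) b (fun s _ => hφ s)
  rw [hsum, ← Finset.sum_sdiff_sub_sum_sdiff]
  have h1 := hb (F' \ F)
  have h2 := hb (F \ F')
  rw [hc2] at h2
  rw [hc1] at h1 h2
  calc _ ≤ |∑ s ∈ F' \ F, φ s| + |∑ s ∈ F \ F', φ s| := abs_sub _ _
    _ ≤ _ := by linarith

end Invariance

/-! ### Empirical measures along orbits. -/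

section Empirical

variable {Γ X : Type*} [Group Γ] [MulAction Γ X] [MeasurableSpace X]

/-- The uniform probability measure on the points `s x`, `s ∈ F`. -/
def empirical (F : Finset Γ) (x : X) : Measure X :=
  (F.card : ℝ≥0∞)⁻¹ • ∑ s ∈ F, Measure.dirac (s • x)

theorem empirical_isProbabilityMeasure {F : Finset Γ} (hF : F.Nonempty) (x : X) :
    IsProbabilityMeasure (empirical F x) := by
  constructor
  have h0 : (F.card : ℝ≥0∞) ≠ 0 := by simpa using hF.ne_empty
  simp [empirical, ENNReal.inv_mul_cancel h0]

open Classical in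
theorem empirical_real_apply (F : Finset Γ) (x : X) {A : Set X} (hA : MeasurableSet A) :
    (empirical F x).real A = (F.card : ℝ)⁻¹ * (F.filter fun s => s • x ∈ A).card := by
  have : (∑ s ∈ F, Measure.dirac (s • x)) A = ((F.filter fun s => s • x ∈ A).card : ℝ≥0∞) := by
    rw [Measure.finsetSum_apply, Finset.card_filter]
    push_cast
    refine Finset.sum_congr rfl fun s _ => ?_
    rw [Measure.dirac_apply' _ hA, Set.indicator_apply]
    simp
  simp [Measure.real, empirical, this]

theorem integral_empirical [TopologicalSpace X] [OpensMeasurableSpace X]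
    (F : Finset Γ) (x : X) {f : X → ℝ} (hf : Continuous f) :
    ∫ y, f y ∂(empirical F x) = (F.card : ℝ)⁻¹ * ∑ s ∈ F, f (s • x) := by
  have hd : ∀ a : X, ∫ y, f y ∂(Measure.dirac a) = f a := fun a =>
    integral_dirac' _ _ hf.stronglyMeasurable
  rw [empirical, integral_smul_measure, integral_finsetSum_measure]
  · simp [hd]
  · intro s _
    exact integrable_dirac' hf.stronglyMeasurable (by simp)

end Empirical

/-! ### From invariant measures to uniform visit frequencies. -/

section Limit

variable {Γ X : Type*} [Group Γ] [MulAction Γ X] [MetricSpace X] [CompactSpace X]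
  [MeasurableSpace X] [BorelSpace X] [ContinuousConstSMul Γ X]

open Classical in
/-- A strict bound for the invariant measures of two closed sets gives a uniform bound for the
frequencies of visits of sufficiently invariant finite sets to neighbourhoods of these sets. -/
theorem exists_uniform_frequency_bound {C D : Set X} (hC : IsClosed C) (hD : IsClosed D) {c : ℝ}
    (h : ∀ μ : Measure X, IsProbabilityMeasure μ → SMulInvariantMeasure Γ X μ →
      μ.real C + μ.real D < c) :
    ∃ (K : Finset Γ) (δ η ε : ℝ), 0 < δ ∧ 0 < η ∧ 0 < ε ∧
      ∀ F : Finset Γ, F.Nonempty → IsInvariantShape K δ F → ∀ x : X,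
        ((F.filter fun s => s • x ∈ Metric.cthickening η C).card : ℝ) +
          (F.filter fun s => s • x ∈ Metric.cthickening η D).card ≤ (c - ε) * F.card := by
  by_contra! hcon
  have hpos : ∀ m : ℕ, (0 : ℝ) < 1 / ((m : ℝ) + 1) := fun m => Nat.one_div_pos_of_nat
  -- Counterexamples are indexed by all finite sets K together with an error 1/(m+1). An ultrafilter
  -- on this directed set replaces a subsequence, so Γ need not be countable.
  choose F hF hinv x hx using fun p : Finset Γ × ℕ =>
    hcon p.1 (1 / (p.2 + 1)) (1 / (p.2 + 1)) (1 / (p.2 + 1)) (hpos _) (hpos _) (hpos _)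
  let ν : Finset Γ × ℕ → ProbabilityMeasure X := fun p =>
    ⟨empirical (F p) (x p), empirical_isProbabilityMeasure (hF p) (x p)⟩
  let 𝒰 : Ultrafilter (Finset Γ × ℕ) := Ultrafilter.of atTop
  have h𝒰 : (𝒰 : Filter (Finset Γ × ℕ)) ≤ atTop := Ultrafilter.of_le _
  obtain ⟨μ, -, hμ⟩ := (isCompact_univ (X := ProbabilityMeasure X)).ultrafilter_le_nhds
    (𝒰.map ν) (by simp)
  have hlim : Tendsto ν 𝒰 (𝓝 μ) := hμ
  have hsnd : Tendsto (fun p : Finset Γ × ℕ => (1 : ℝ) / ((p.2 : ℝ) + 1)) 𝒰 (𝓝 0) :=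
    (tendsto_one_div_add_atTop_nhds_zero_nat.comp
      (tendsto_snd.mono_left (prod_atTop_atTop_eq (α := Finset Γ) (β := ℕ)).ge)).mono_left h𝒰
  have hmem : ∀ K : Finset Γ, ∀ᶠ p in (𝒰 : Filter (Finset Γ × ℕ)), K ⊆ p.1 := fun K =>
    h𝒰 ((eventually_ge_atTop ((K, 0) : Finset Γ × ℕ)).mono fun p hp => hp.1)
  -- Translating a test function by g changes its empirical integral by at most 2‖f‖ times the
  -- proportion of the shape that g moves out, which tends to 0.
  have hinvμ : SMulInvariantMeasure Γ X (μ : Measure X) := by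
    refine ⟨fun g A hA => ?_⟩
    have hcont : Continuous fun y : X => g • y := continuous_const_smul g
    rw [← Measure.map_apply hcont.measurable hA]
    congr 1
    have : IsFiniteMeasure ((μ : Measure X).map fun y => g • y) :=
      Measure.isFiniteMeasure_map _ _
    refine ext_of_forall_integral_eq_of_IsFiniteMeasure fun f => ?_
    rw [integral_map hcont.measurable.aemeasurable
      f.continuous.stronglyMeasurable.aestronglyMeasurable]
    let fg : BoundedContinuousFunction X ℝ := f.compContinuous ⟨_, hcont⟩
    have hl := ProbabilityMeasure.tendsto_iff_forall_integral_tendsto.1 hlim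
    have hdiff := (hl fg).sub (hl f)
    have hzero : Tendsto (fun p => ∫ y, fg y ∂(ν p : Measure X) - ∫ y, f y ∂(ν p : Measure X))
        𝒰 (𝓝 0) := by
      have hb : Tendsto (fun p : Finset Γ × ℕ => 2 * ‖f‖ * ((1 : ℝ) / ((p.2 : ℝ) + 1)))
          𝒰 (𝓝 0) := by simpa using hsnd.const_mul (2 * ‖f‖)
      refine squeeze_zero_norm' ?_ hb
      filter_upwards [hmem {1, g}] with p hp
      have h1 : (1 : Γ) ∈ p.1 := hp (by simp)
      have h2 : g ∈ p.1 := hp (by simp)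
      have e1 := integral_empirical (F p) (x p) fg.continuous
      have e2 := integral_empirical (F p) (x p) f.continuous
      change ‖∫ y, fg y ∂(empirical (F p) (x p)) - ∫ y, f y ∂(empirical (F p) (x p))‖ ≤ _
      rw [e1, e2, ← mul_sub, Real.norm_eq_abs, abs_mul]
      have hc : (0 : ℝ) < (F p).card := by exact_mod_cast (hF p).card_pos
      have h3 := abs_sum_translate_sub_le (F p) g (fun t => f (t • x p)) (b := ‖f‖)
        (fun t => f.norm_coe_le_norm _)
      have h4 : (((F p).filter fun s => g * s ∉ F p).card : ℝ) ≤
          1 / ((p.2 : ℝ) + 1) * (F p).card :=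
        le_trans (by exact_mod_cast card_filter_exit_le h1 h2) (hinv p)
      have h5 : |∑ s ∈ F p, fg (s • x p) - ∑ s ∈ F p, f (s • x p)| ≤
          2 * ‖f‖ * (1 / ((p.2 : ℝ) + 1) * (F p).card) := by
        refine le_trans ?_ (h3.trans (by gcongr))
        simp [fg, mul_smul]
      rw [abs_of_pos (inv_pos.2 hc), inv_mul_le_iff₀ hc]
      linarith
    have := tendsto_nhds_unique hdiff hzero
    simp only [fg] at this
    exact sub_eq_zero.1 this
  have key : ∀ E : Set X, IsClosed E → ∀ r : ℝ, (μ : Measure X).real E < r →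
      ∀ᶠ p in (𝒰 : Filter (Finset Γ × ℕ)), (ν p : Measure X).real E < r := by
    intro E hE r hr
    have h1 := ProbabilityMeasure.limsup_measure_closed_le_of_tendsto hlim hE
    have h2 : (μ : Measure X) E < ENNReal.ofReal r := by
      rw [← ofReal_measureReal]
      exact (ENNReal.ofReal_lt_ofReal_iff (measureReal_nonneg.trans_lt hr)).2 hr
    have h3 := eventually_lt_of_limsup_lt (h1.trans_lt h2)
    filter_upwards [h3] with p hp
    rw [← ofReal_measureReal] at hp
    exact (ENNReal.ofReal_lt_ofReal_iff (measureReal_nonneg.trans_lt hr)).1 hp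
  have hlt := h μ inferInstance hinvμ
  -- One r is spent on each thickening and one on the error 1/(m+1); the rest is slack.
  obtain ⟨r, hr0, hr⟩ : ∃ r : ℝ, 0 < r ∧
      (μ : Measure X).real C + (μ : Measure X).real D + 5 * r < c :=
    ⟨(c - ((μ : Measure X).real C + (μ : Measure X).real D)) / 6, by linarith, by linarith⟩
  have hthick : ∀ E : Set X, IsClosed E → ∀ᶠ η in 𝓝 (0 : ℝ),
      (μ : Measure X).real (Metric.cthickening η E) < (μ : Measure X).real E + r := by
    intro E hE
    have h1 := tendsto_measure_cthickening_of_isClosed (μ := (μ : Measure X)) (s := E)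
      ⟨1, one_pos, measure_ne_top _ _⟩ hE
    have h2 := (ENNReal.tendsto_toReal (measure_ne_top (μ : Measure X) E)).comp h1
    exact h2.eventually (gt_mem_nhds (by simpa [Measure.real] using hr0))
  -- The radius is fixed before p, since the portmanteau bound `key` concerns a fixed closed set;
  -- afterwards p is taken with 1/(m+1) below η.
  obtain ⟨η, ⟨hηC, hηD⟩, hη⟩ : ∃ η : ℝ,
      ((μ : Measure X).real (Metric.cthickening η C) < (μ : Measure X).real C + r ∧
      (μ : Measure X).real (Metric.cthickening η D) < (μ : Measure X).real D + r) ∧ 0 < η := by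
    have h1 := ((hthick C hC).and (hthick D hD)).filter_mono
      (nhdsWithin_le_nhds (s := Set.Ioi (0 : ℝ)))
    exact (h1.and self_mem_nhdsWithin).exists
  have e1 := key _ Metric.isClosed_cthickening _ hηC
  have e2 := key _ Metric.isClosed_cthickening _ hηD
  have e3 := hsnd.eventually (gt_mem_nhds hη)
  have e4 := hsnd.eventually (gt_mem_nhds hr0)
  obtain ⟨p, ⟨hp1, hp2⟩, hp3, hp4⟩ := ((e1.and e2).and (e3.and e4)).exists
  have hc : (0 : ℝ) < (F p).card := by exact_mod_cast (hF p).card_pos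
  have hxp := hx p
  change (empirical (F p) (x p)).real _ < _ at hp1
  change (empirical (F p) (x p)).real _ < _ at hp2
  rw [empirical_real_apply _ _ Metric.isClosed_cthickening.measurableSet,
    inv_mul_lt_iff₀ hc] at hp1 hp2
  have hmono : ∀ E : Set X,
      (((F p).filter fun s => s • x p ∈ Metric.cthickening (1 / ((p.2 : ℝ) + 1)) E).card : ℝ) ≤
        ((F p).filter fun s => s • x p ∈ Metric.cthickening η E).card := by
    intro E
    exact_mod_cast Finset.card_le_card (Finset.monotone_filter_right _
      fun s _ hs => Metric.cthickening_mono hp3.le E hs)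
  have m1 := hmono C
  have m2 := hmono D
  nlinarith

end Limit

/-! ### Castles, subequivalence and invariant measures. -/

section Castles

variable {Γ X : Type*} [Group Γ] [MulAction Γ X]

theorem mem_towerFootprint {S : Finset Γ} {V : Set X} {x : X} :
    x ∈ towerFootprint S V ↔ ∃ s ∈ S, x ∈ s • V := by
  simp [towerFootprint]

theorem mem_castleFootprint {k : ℕ} {S : Fin k → Finset Γ} {V : Fin k → Set X} {x : X} :
    x ∈ castleFootprint S V ↔ ∃ i, ∃ s ∈ S i, x ∈ s • V i := by
  simp [castleFootprint, towerFootprint]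

/-- Two levels of a castle with a common point coincide. -/
theorem IsCastle.eq_of_mem {k : ℕ} {S : Fin k → Finset Γ} {V : Fin k → Set X} (h : IsCastle S V)
    {i j : Fin k} {s t : Γ} (hs : s ∈ S i) (ht : t ∈ S j) {x : X} (hx : x ∈ s • V i)
    (hy : x ∈ t • V j) : i = j ∧ s = t := by
  have hij : i = j := by
    by_contra hne
    exact Set.disjoint_left.1 (h.disjoint hne) (mem_towerFootprint.2 ⟨s, hs, hx⟩)
      (mem_towerFootprint.2 ⟨t, ht, hy⟩)
  subst hij
  refine ⟨rfl, ?_⟩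
  by_contra hne
  exact Set.disjoint_left.1 (h.tower i hs ht hne) hx hy

/-- A finite family of levels in which distinct levels have no common point is a castle. -/
theorem IsCastle.of_eq_of_mem {k : ℕ} {S : Fin k → Finset Γ} {V : Fin k → Set X}
    (h : ∀ i j, ∀ s ∈ S i, ∀ t ∈ S j, ∀ x, x ∈ s • V i → x ∈ t • V j → i = j ∧ s = t) :
    IsCastle S V where
  tower i s hs t ht hne := Set.disjoint_left.2 fun x hx hx' => hne (h i i s hs t ht x hx hx').2
  disjoint i j hne := Set.disjoint_left.2 fun x hx hx' => by
    obtain ⟨s, hs, hxs⟩ := mem_towerFootprint.1 hx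
    obtain ⟨t, ht, hxt⟩ := mem_towerFootprint.1 hx'
    exact hne (h i j s hs t ht x hxs hxt).1

section Topology

variable [TopologicalSpace X]

/-- A witness for subequivalence indexed by an arbitrary finite type. -/
theorem exists_fin_pieces {κ : Type*} [Finite κ] {C B : Set X} (U : κ → Set X) (g : κ → Γ)
    (hU : ∀ k, IsOpen (U k)) (hC : C ⊆ ⋃ k, U k)
    (hd : Pairwise fun i j => Disjoint (g i • U i) (g j • U j)) (hB : ∀ k, g k • U k ⊆ B) :
    ∃ (n : ℕ) (U : Fin n → Set X) (s : Fin n → Γ),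
      (∀ i, IsOpen (U i)) ∧ C ⊆ ⋃ i, U i ∧
      (Pairwise fun i j => Disjoint (s i • U i) (s j • U j)) ∧ ∀ i, s i • U i ⊆ B := by
  obtain ⟨n, ⟨e⟩⟩ := Finite.exists_equiv_fin κ
  refine ⟨n, U ∘ e.symm, g ∘ e.symm, fun i => hU _, ?_, fun i j hij => ?_, fun i => hB _⟩
  · intro x hx
    obtain ⟨k, hk⟩ := Set.mem_iUnion.1 (hC hx)
    exact Set.mem_iUnion.2 ⟨e k, by simpa using hk⟩
  · exact hd (e.symm.injective.ne hij)

theorem IsOpenCastle.mono {k : ℕ} {S S₁ : Fin k → Finset Γ} {V : Fin k → Set X}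
    (hc : IsOpenCastle S V) (h : ∀ i, S₁ i ⊆ S i) : IsOpenCastle S₁ V :=
  ⟨IsCastle.of_eq_of_mem fun _ _ _ hs _ ht _ hx hx' =>
    hc.castle.eq_of_mem (h _ hs) (h _ ht) hx hx', hc.isOpen⟩

variable [ContinuousConstSMul Γ X]

theorem isOpen_towerFootprint (S : Finset Γ) {V : Set X} (hV : IsOpen V) :
    IsOpen (towerFootprint S V) :=
  isOpen_biUnion fun s _ => hV.smul s

theorem isOpen_castleFootprint {k : ℕ} (S : Fin k → Finset Γ) {V : Fin k → Set X}
    (hV : ∀ i, IsOpen (V i)) : IsOpen (castleFootprint S V) :=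
  isOpen_iUnion fun i => isOpen_towerFootprint (S i) (hV i)

/-- The closure of a union of levels of an open castle adds only points outside the castle. -/
theorem IsOpenCastle.closure_levels_subset {k : ℕ} {S : Fin k → Finset Γ} {V : Fin k → Set X}
    (h : IsOpenCastle S V) (L : Fin k → Finset Γ) (hL : ∀ i, L i ⊆ S i) :
    closure (castleFootprint L V) ⊆ castleFootprint L V ∪ (castleFootprint S V)ᶜ := by
  intro x hx
  by_cases hxS : x ∈ castleFootprint S V
  · obtain ⟨i, s, hs, hxs⟩ := mem_castleFootprint.1 hxS
    obtain ⟨y, hys, hyL⟩ := mem_closure_iff.1 hx _ ((h.isOpen i).smul s) hxs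
    obtain ⟨j, t, ht, hyt⟩ := mem_castleFootprint.1 hyL
    obtain ⟨rfl, rfl⟩ := h.castle.eq_of_mem hs (hL j ht) hys hyt
    exact Or.inl (mem_castleFootprint.2 ⟨i, s, ht, hxs⟩)
  · exact Or.inr hxS

end Topology

section Measure

variable [MeasurableSpace X] {μ : Measure X} [SMulInvariantMeasure Γ X μ]

theorem measureReal_smul_set [MeasurableConstSMul Γ X] (g : Γ) (A : Set X) :
    μ.real (g • A) = μ.real A := by
  simp [Measure.real, measure_smul]

theorem measureReal_towerFootprint_le [MeasurableConstSMul Γ X] (S : Finset Γ) (V : Set X) :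
    μ.real (towerFootprint S V) ≤ S.card * μ.real V := by
  refine (measureReal_biUnion_finset_le S _).trans ?_
  simp [measureReal_smul_set]

theorem measureReal_castleFootprint_le [MeasurableConstSMul Γ X] {k : ℕ} (S : Fin k → Finset Γ)
    (V : Fin k → Set X) :
    μ.real (castleFootprint S V) ≤ ∑ i, (S i).card * μ.real (V i) := by
  refine (measureReal_iUnion_fintype_le _).trans ?_
  exact Finset.sum_le_sum fun i _ => measureReal_towerFootprint_le _ _

variable [TopologicalSpace X] [BorelSpace X] [ContinuousConstSMul Γ X] [IsProbabilityMeasure μ]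

theorem measureReal_towerFootprint {S : Finset Γ} {V : Set X} (h : IsTower S V) (hV : IsOpen V) :
    μ.real (towerFootprint S V) = S.card * μ.real V := by
  have := measureReal_biUnion_finset (μ := μ) h fun s _ => (hV.smul s).measurableSet
  rw [towerFootprint, this]
  simp [measureReal_smul_set]

theorem IsOpenCastle.measureReal_castleFootprint {k : ℕ} {S : Fin k → Finset Γ}
    {V : Fin k → Set X} (h : IsOpenCastle S V) :
    μ.real (castleFootprint S V) = ∑ i, (S i).card * μ.real (V i) := by
  rw [castleFootprint, measureReal_iUnion_fintype h.castle.disjoint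
    fun i => (isOpen_towerFootprint _ (h.isOpen i)).measurableSet]
  exact Finset.sum_congr rfl fun i _ => measureReal_towerFootprint (h.castle.tower i) (h.isOpen i)

theorem IsOpenCastle.sum_card_mul_le_one {k : ℕ} {S : Fin k → Finset Γ}
    {V : Fin k → Set X} (h : IsOpenCastle S V) :
    ∑ i, (S i).card * μ.real (V i) ≤ 1 := by
  rw [← h.measureReal_castleFootprint]
  exact measureReal_le_one

variable (μ) in
theorem Subequiv.measureReal_le {A B : Set X} (h : Subequiv Γ A B) (hA : IsClosed A) :
    μ.real A ≤ μ.real B := by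
  obtain ⟨n, U, s, hU, hC, hd, hB⟩ := h A hA subset_rfl
  calc μ.real A ≤ μ.real (⋃ i, U i) := measureReal_mono hC
    _ ≤ ∑ i, μ.real (U i) := measureReal_iUnion_fintype_le _
    _ = ∑ i, μ.real (s i • U i) := by simp [measureReal_smul_set]
    _ = μ.real (⋃ i, s i • U i) :=
        (measureReal_iUnion_fintype hd fun i => ((hU i).smul _).measurableSet).symm
    _ ≤ μ.real B := measureReal_mono (Set.iUnion_subset hB)

end Measure

end Castles

/-! ### Comparison for almost finite actions. -/

section AlmostFiniteActions

variable {Γ X : Type*} [Group Γ] [MulAction Γ X] [MetricSpace X]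

/-- If only the empty set were invariant enough, the castle would be empty and X would be
subequivalent to the empty set. -/
theorem AlmostFinite.exists_invariantShape [Nonempty X] (h : AlmostFinite Γ X) (K : Finset Γ)
    {δ : ℝ} (hδ : 0 < δ) : ∃ F : Finset Γ, F.Nonempty ∧ IsInvariantShape K δ F := by
  obtain ⟨k, S, V, -, hinv, -, S', hS', -, hsub⟩ := h 1 K δ one_pos hδ
  by_contra! hcon
  have hS : ∀ i, S i = ∅ := fun i => by
    by_contra hne
    exact hcon _ (Finset.nonempty_iff_ne_empty.2 hne) (hinv i)
  have hS'' : ∀ i, S' i = ∅ := fun i => Finset.subset_empty.1 (hS i ▸ hS' i)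
  have h0 : castleFootprint S V = ∅ := by
    simp [castleFootprint, towerFootprint, hS]
  have h1 : castleFootprint S' V = ∅ := by
    simp [castleFootprint, towerFootprint, hS'']
  rw [h0, h1] at hsub
  obtain ⟨n, U, s, -, hC, -, hB⟩ := hsub Set.univ isClosed_univ (by simp)
  obtain ⟨i, hi⟩ := Set.mem_iUnion.1 (hC (Set.mem_univ (Classical.arbitrary X)))
  exact hB i (Set.smul_mem_smul_set hi)

variable [ContinuousConstSMul Γ X] [MeasurableSpace X] [BorelSpace X]

/-- An almost finite action has castles whose complement is small for all invariant measures. -/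
theorem AlmostFinite.exists_castle (h : AlmostFinite Γ X) (K : Finset Γ) {δ ε : ℝ} (hδ : 0 < δ)
    (hε : 0 < ε) :
    ∃ (k : ℕ) (S : Fin k → Finset Γ) (V : Fin k → Set X),
      IsOpenCastle S V ∧ (∀ i, IsInvariantShape K δ (S i)) ∧
      (∀ i, ∀ s ∈ S i, Metric.diam (s • V i) < δ) ∧
      ∀ μ : Measure X, IsProbabilityMeasure μ → SMulInvariantMeasure Γ X μ →
        μ.real (castleFootprint S V)ᶜ ≤ ε := by
  obtain ⟨N, hN⟩ := exists_nat_gt (1 / ε)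
  have hN0 : (0 : ℝ) < N := (one_div_pos.2 hε).trans hN
  obtain ⟨k, S, V, hc, hinv, hdiam, S', hS', hcard, hsub⟩ := h N K δ (by exact_mod_cast hN0) hδ
  refine ⟨k, S, V, hc, hinv, hdiam, fun μ hμ hμi => ?_⟩
  have h1 := hsub.measureReal_le μ (isOpen_castleFootprint S hc.isOpen).isClosed_compl
  have h2 : ∑ i, (S' i).card * μ.real (V i) ≤ ∑ i, (1 / N : ℝ) * ((S i).card * μ.real (V i)) := by
    refine Finset.sum_le_sum fun i _ => ?_
    have := mul_le_mul_of_nonneg_right (hcard i) (measureReal_nonneg (μ := μ) (s := V i))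
    calc _ ≤ _ := this
      _ = _ := by ring
  rw [← Finset.mul_sum] at h2
  have h3 := hc.sum_card_mul_le_one (μ := μ)
  have h4 : (1 / N : ℝ) < ε := by rwa [div_lt_iff₀ hN0, mul_comm, ← div_lt_iff₀ hε]
  have h5 : (1 / N : ℝ) * ∑ i, ((S i).card * μ.real (V i)) ≤ (1 / N : ℝ) * 1 := by gcongr
  have h6 := measureReal_castleFootprint_le (μ := μ) S' V
  linarith

variable [CompactSpace X]

open Classical in
/-- A closed set that is small for all invariant measures has a neighbourhood that is. -/
theorem AlmostFinite.exists_cthickening_le (h : AlmostFinite Γ X) {C : Set X} (hC : IsClosed C)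
    {c : ℝ} (hμ : ∀ μ : Measure X, IsProbabilityMeasure μ → SMulInvariantMeasure Γ X μ →
      μ.real C < c) :
    ∃ η : ℝ, 0 < η ∧ ∀ μ : Measure X, IsProbabilityMeasure μ → SMulInvariantMeasure Γ X μ →
      μ.real (Metric.cthickening η C) ≤ c := by
  rcases isEmpty_or_nonempty X with hX | hX
  · refine ⟨1, one_pos, fun μ hp hi => ?_⟩
    rw [Set.eq_empty_of_isEmpty (Metric.cthickening 1 C), ← Set.eq_empty_of_isEmpty C]
    exact (hμ μ hp hi).le
  obtain ⟨K, δ, η, ε, hδ, hη, hε, hb⟩ := exists_uniform_frequency_bound (Γ := Γ) hC isClosed_empty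
    (c := c) (by simpa using hμ)
  obtain ⟨F, hF, hinv⟩ := h.exists_invariantShape K hδ
  have hc : (0 : ℝ) < F.card := by exact_mod_cast hF.card_pos
  refine ⟨η, hη, fun μ hp hi => ?_⟩
  have hm : MeasurableSet (Metric.cthickening η C) := Metric.isClosed_cthickening.measurableSet
  -- The pointwise frequency bound for the single set F is integrated; by invariance each s ∈ F
  -- contributes the measure of the thickening.
  have h1 : ∀ s : Γ, ∫ x, (Metric.cthickening η C).indicator (fun _ => (1 : ℝ)) (s • x) ∂μ =
      μ.real (Metric.cthickening η C) := fun s => by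
    have : (fun x => (Metric.cthickening η C).indicator (fun _ => (1 : ℝ)) (s • x)) =
        (s⁻¹ • Metric.cthickening η C).indicator fun _ => (1 : ℝ) := by
      ext x
      simp [Set.indicator_apply, Set.mem_smul_set_iff_inv_smul_mem]
    rw [this, integral_indicator_const _ (hm.const_smul _), measureReal_smul_set]
    simp
  have hint : ∀ s : Γ, Integrable
      (fun x => (Metric.cthickening η C).indicator (fun _ => (1 : ℝ)) (s • x)) μ := fun s => by
    refine Integrable.of_bound (C := 1) ?_ ?_
    · exact (((measurable_const.indicator hm).comp (measurable_const_smul s))).aestronglyMeasurable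
    · refine Eventually.of_forall fun x => ?_
      by_cases hx : s • x ∈ Metric.cthickening η C <;> simp [hx]
  have h2 : ∫ x, ∑ s ∈ F, (Metric.cthickening η C).indicator (fun _ => (1 : ℝ)) (s • x) ∂μ =
      F.card * μ.real (Metric.cthickening η C) := by
    rw [integral_finsetSum _ fun s _ => hint s]
    simp [h1]
  have h3 : ∫ x, ∑ s ∈ F, (Metric.cthickening η C).indicator (fun _ => (1 : ℝ)) (s • x) ∂μ ≤
      ∫ _, (c - ε) * F.card ∂μ := by
    refine integral_mono (integrable_finsetSum _ fun s _ => hint s) (integrable_const _) ?_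
    intro x
    have := hb F hF hinv x
    simp only [Metric.cthickening_empty, Set.mem_empty_iff_false, Finset.filter_false,
      Finset.card_empty, Nat.cast_zero, add_zero] at this
    refine le_trans (le_of_eq ?_) this
    simp [Set.indicator_apply]
  rw [h2] at h3
  simp only [integral_const, probReal_univ, one_smul] at h3
  nlinarith

open Classical in
/-- Comparison for almost finite actions. -/
theorem AlmostFinite.subequiv (h : AlmostFinite Γ X) {C O : Set X} (hC : IsClosed C)
    (hO : IsOpen O) (hμ : ∀ μ : Measure X, IsProbabilityMeasure μ → SMulInvariantMeasure Γ X μ →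
      μ C < μ O) : Subequiv Γ C O := by
  intro C' hC' hC'C
  obtain ⟨K, δ, η, ε, hδ, hη, hε, hb⟩ := exists_uniform_frequency_bound (Γ := Γ) hC
    hO.isClosed_compl (c := 1) (fun μ hp hi => by
      have h1 : μ.real C < μ.real O :=
        (ENNReal.toReal_lt_toReal (measure_ne_top _ _) (measure_ne_top _ _)).2 (hμ μ hp hi)
      rw [probReal_compl_eq_one_sub hO.measurableSet]
      linarith)
  obtain ⟨N, hN⟩ := exists_nat_gt (1 / ε)
  have hN0 : (0 : ℝ) < N := (one_div_pos.2 hε).trans hN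
  obtain ⟨k, S, V, hc, hinv, hdiam, S', hS', hcard, hsub⟩ :=
    h N K (min δ η) (by exact_mod_cast hN0) (lt_min hδ hη)
  -- In each tower, the levels meeting C together with the reserve S' that receives the remainder
  -- must fit into the levels inside O. Levels have diameter below η, so the visits of a single
  -- point to the η-thickenings of C and Oᶜ control both counts, and ε leaves room for S'.
  set a : Fin k → Finset Γ := fun i => (S i).filter fun s => (s • V i ∩ C).Nonempty with ha
  set b : Fin k → Finset Γ := fun i => (S i).filter fun s => s • V i ⊆ O with hb'
  have hNε : (1 / N : ℝ) ≤ ε := by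
    rw [div_le_iff₀ hN0, mul_comm, ← div_le_iff₀ hε]; exact hN.le
  have hcount : ∀ i, (a i).card + (S' i).card ≤ (b i).card := by
    intro i
    rcases (V i).eq_empty_or_nonempty with hV | ⟨x, hx⟩
    · have h1 : a i = ∅ := by simp [ha, hV]
      have h2 : b i = S i := by simp [hb', hV]
      rw [h1, h2]
      simpa using Finset.card_le_card (hS' i)
    rcases (S i).eq_empty_or_nonempty with hS | hS
    · have h1 : a i = ∅ := by simp [ha, hS]
      have h2 : S' i = ∅ := Finset.subset_empty.1 (hS ▸ hS' i)
      simp [h1, h2]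
    have hfreq := hb (S i) hS ((hinv i).mono subset_rfl (min_le_left _ _)) x
    have hnear : ∀ s ∈ S i, ∀ y ∈ s • V i, ∀ E : Set X, y ∈ E → s • x ∈ Metric.cthickening η E := by
      intro s hs y hy E hyE
      refine Metric.mem_cthickening_of_dist_le _ y _ _ hyE ?_
      have := Metric.dist_le_diam_of_mem (Metric.isBounded_of_compactSpace)
        (Set.smul_mem_smul_set (a := s) hx) hy
      exact this.trans ((hdiam i s hs).le.trans (min_le_right _ _))
    have h1 : (a i).card ≤ ((S i).filter fun s => s • x ∈ Metric.cthickening η C).card := by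
      refine Finset.card_le_card fun s hs => ?_
      obtain ⟨hsS, y, hy, hyC⟩ := Finset.mem_filter.1 hs
      exact Finset.mem_filter.2 ⟨hsS, hnear s hsS y hy C hyC⟩
    have h2 : (S i).card ≤ (b i).card +
        ((S i).filter fun s => s • x ∈ Metric.cthickening η Oᶜ).card := by
      rw [← Finset.card_filter_add_card_filter_not (s := S i) fun s => s • V i ⊆ O]
      refine Nat.add_le_add_left (Finset.card_le_card fun s hs => ?_) _
      obtain ⟨hsS, hn⟩ := Finset.mem_filter.1 hs
      obtain ⟨y, hy, hyO⟩ := Set.not_subset.1 hn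
      exact Finset.mem_filter.2 ⟨hsS, hnear s hsS y hy _ hyO⟩
    have h3 : ((S' i).card : ℝ) ≤ ε * (S i).card := by
      refine (hcard i).trans ?_
      rw [div_eq_mul_one_div, mul_comm]
      gcongr
    have h1' : ((a i).card : ℝ) ≤ _ := Nat.cast_le.2 h1
    have h2' : ((S i).card : ℝ) ≤ _ := Nat.cast_le.2 h2
    push_cast at h2'
    have : ((a i).card : ℝ) + (S' i).card ≤ (b i).card := by linarith
    exact_mod_cast this
  have hψ : ∀ i, ∃ ψ : (a i) ⊕ (S' i) → b i, Function.Injective ψ := fun i => by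
    obtain ⟨e⟩ := Function.Embedding.nonempty_of_card_le (α := (a i) ⊕ (S' i)) (β := b i)
      (by simpa using hcount i)
    exact ⟨e, e.injective⟩
  choose ψ hψ using hψ
  have hRc : IsClosed ((castleFootprint S V)ᶜ ∩ C) :=
    (isOpen_castleFootprint S hc.isOpen).isClosed_compl.inter hC
  obtain ⟨n, U, g, hU, hcov, hdisj, hB⟩ := hsub _ hRc Set.inter_subset_left
  -- A level meeting C is moved along its tower; a piece of the remainder is first sent by g into a
  -- level of S' and then moved along that tower. Two pieces with the same target level come from
  -- one level of S', where the images under g are already disjoint.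
  let κ := (Σ i, a i) ⊕ (Fin n × Σ i, S' i)
  let W : κ → Set X := Sum.elim (fun p => (p.2 : Γ) • V p.1)
    (fun p => U p.1 ∩ (g p.1)⁻¹ • (p.2.2 : Γ) • V p.2.1)
  let t : κ → Σ i, b i := Sum.elim (fun p => ⟨p.1, ψ p.1 (Sum.inl p.2)⟩)
    (fun p => ⟨p.2.1, ψ p.2.1 (Sum.inr p.2.2)⟩)
  let γ : κ → Γ := fun q => ((t q).2 : Γ) * Sum.elim (fun p => (p.2 : Γ)⁻¹)
    (fun p => (p.2.2 : Γ)⁻¹ * g p.1) q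
  have hsubset : ∀ q, γ q • W q ⊆ ((t q).2 : Γ) • V (t q).1 := by
    rintro (p | p)
    · simp [γ, W, t, mul_smul]
    · simp only [γ, W, t, Sum.elim_inr, mul_smul]
      refine Set.smul_set_mono ?_
      rw [Set.smul_set_inter]
      rw [Set.smul_set_inter]
      refine Set.inter_subset_right.trans ?_
      simp
  refine exists_fin_pieces W γ ?_ ?_ ?_ ?_
  · rintro (p | p)
    · exact (hc.isOpen _).smul _
    · exact (hU _).inter (((hc.isOpen _).smul _).smul _)
  · intro x hx
    have hxC := hC'C hx
    by_cases hxS : x ∈ castleFootprint S V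
    · obtain ⟨i, s, hs, hxs⟩ := mem_castleFootprint.1 hxS
      exact Set.mem_iUnion.2 ⟨Sum.inl ⟨i, ⟨s, Finset.mem_filter.2 ⟨hs, x, hxs, hxC⟩⟩⟩, hxs⟩
    · obtain ⟨l, hl⟩ := Set.mem_iUnion.1 (hcov ⟨hxS, hxC⟩)
      obtain ⟨i, s, hs, hxs⟩ := mem_castleFootprint.1 (hB l (Set.smul_mem_smul_set hl))
      refine Set.mem_iUnion.2 ⟨Sum.inr (l, ⟨i, ⟨s, hs⟩⟩), hl, ?_⟩
      exact Set.mem_smul_set_iff_inv_smul_mem.2 (by simpa using hxs)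
  · intro q q' hne
    by_contra hnd
    obtain ⟨y, hy, hy'⟩ := Set.not_disjoint_iff.1 hnd
    have hlev := hc.castle.eq_of_mem (Finset.filter_subset _ _ (t q).2.2)
      (Finset.filter_subset _ _ (t q').2.2) (hsubset q hy) (hsubset q' hy')
    have htt : t q = t q' := by
      refine Sigma.ext hlev.1 ?_
      have := hlev.2
      generalize t q = u at *
      generalize t q' = v at *
      obtain ⟨i, u⟩ := u
      obtain ⟨j, v⟩ := v
      obtain ⟨rfl, -⟩ := hlev
      exact heq_of_eq (Subtype.ext this)
    rcases q with ⟨i, s⟩ | ⟨l, i, s⟩ <;> rcases q' with ⟨j, r⟩ | ⟨l', j, r⟩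
    · obtain rfl : i = j := hlev.1
      have := hψ i (eq_of_heq (Sigma.mk.inj htt).2)
      simp only [Sum.inl.injEq] at this
      exact hne (by rw [this])
    · obtain rfl : i = j := hlev.1
      have := hψ i (eq_of_heq (Sigma.mk.inj htt).2)
      simp at this
    · obtain rfl : i = j := hlev.1
      have := hψ i (eq_of_heq (Sigma.mk.inj htt).2)
      simp at this
    · obtain rfl : i = j := hlev.1
      have := hψ i (eq_of_heq (Sigma.mk.inj htt).2)
      simp only [Sum.inr.injEq] at this
      subst this
      have hll : l ≠ l' := fun hl => hne (by rw [hl])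
      have hγ : ∀ m, γ (Sum.inr (m, ⟨i, s⟩)) • W (Sum.inr (m, ⟨i, s⟩)) ⊆
          ((ψ i (Sum.inr s) : Γ) * (s : Γ)⁻¹) • g m • U m := fun m => by
        simp only [γ, W, t, Sum.elim_inr, mul_smul]
        exact Set.smul_set_mono (Set.smul_set_mono (Set.smul_set_mono Set.inter_subset_left))
      have hd := (Set.disjoint_smul_set (a := (ψ i (Sum.inr s) : Γ) * (s : Γ)⁻¹)).2 (hdisj hll)
      exact Set.disjoint_left.1 hd (hγ l hy) (hγ l' hy')
  · intro q
    exact (hsubset q).trans (Finset.mem_filter.1 (t q).2.2).2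

/-- One class suffices: all pieces go into class 0 and the others stay empty. -/
theorem AlmostFinite.hasMComparison (h : AlmostFinite Γ X) (m : ℕ) : HasMComparison Γ X m := by
  intro A B _ hB _ _ hμ C hC hCA
  obtain ⟨n, U, s, hU, hcov, hd, hsB⟩ := h.subequiv hC hB
    (fun μ hp hi => (measure_mono hCA).trans_lt (hμ μ hp hi)) C hC subset_rfl
  exact ⟨n, U, s, fun _ => 0, hU, hcov, fun i j hij _ => hd hij, hsB⟩

end AlmostFiniteActions

/-! ### The small boundary property. -/

section SmallBoundary

variable {Γ X : Type*} [Group Γ] [MulAction Γ X] [MetricSpace X] [CompactSpace X]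
  [MeasurableSpace X] [BorelSpace X] [ContinuousConstSMul Γ X]

open Classical in
/-- Between a closed set and an open neighbourhood one can insert a closed set and a neighbourhood
of it whose difference is small for all invariant measures. -/
theorem AlmostFinite.exists_small_collar (h : AlmostFinite Γ X) {C U : Set X} (hC : IsClosed C)
    (hU : IsOpen U) (hCU : C ⊆ U) {ε : ℝ} (hε : 0 < ε) :
    ∃ A B : Set X, IsClosed A ∧ IsOpen B ∧ A ⊆ B ∧ C ⊆ interior A ∧ closure B ⊆ U ∧
      ∀ μ : Measure X, IsProbabilityMeasure μ → SMulInvariantMeasure Γ X μ →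
        μ.real (closure B \ interior A) ≤ ε := by
  obtain ⟨ρ, hρ, hρU⟩ := hC.isCompact.exists_thickening_subset_open hU hCU
  obtain ⟨k, S, V, hc, -, hdiam, hR⟩ := h.exists_castle ∅ hρ (half_pos hε)
  have hRc : IsClosed (castleFootprint S V)ᶜ :=
    (isOpen_castleFootprint S hc.isOpen).isClosed_compl
  obtain ⟨η, hη, hηR⟩ := h.exists_cthickening_le hRc (c := ε)
    fun μ hp hi => (hR μ hp hi).trans_lt (half_lt_self hε)
  set O := Metric.thickening η (castleFootprint S V)ᶜ with hO
  have hRO : (castleFootprint S V)ᶜ ⊆ O := Metric.self_subset_thickening hη _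
  set L : Fin k → Finset Γ := fun i => (S i).filter fun s => (s • V i ∩ C).Nonempty with hL
  set W := castleFootprint L V with hW
  have hWo : IsOpen W := isOpen_castleFootprint L hc.isOpen
  have hWU : W ⊆ U := by
    intro x hx
    obtain ⟨i, s, hs, hxs⟩ := mem_castleFootprint.1 hx
    obtain ⟨hsS, y, hy, hyC⟩ := Finset.mem_filter.1 hs
    refine hρU (Metric.mem_thickening_iff.2 ⟨y, hyC, ?_⟩)
    exact (Metric.dist_le_diam_of_mem Metric.isBounded_of_compactSpace hxs hy).trans_lt
      (hdiam i s hsS)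
  -- Limit points of W outside W lie in the remainder of the castle, hence in O.
  have hWO : IsClosed (W \ O) := by
    have : W \ O = closure W \ O := by
      refine Set.Subset.antisymm (Set.sdiff_subset_sdiff_left subset_closure) ?_
      rintro x ⟨hx, hxO⟩
      rcases hc.closure_levels_subset L (fun i => Finset.filter_subset _ _) hx with hx | hx
      · exact ⟨hx, hxO⟩
      · exact absurd (hRO hx) hxO
    rw [this]
    exact isClosed_closure.sdiff Metric.isOpen_thickening
  have hE : IsClosed (C ∪ W \ O) := hC.union hWO
  have hU' : IsOpen (W ∪ O ∩ U) := hWo.union (Metric.isOpen_thickening.inter hU)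
  have hEU' : C ∪ W \ O ⊆ W ∪ O ∩ U := by
    rintro x (hx | hx)
    · by_cases hxS : x ∈ castleFootprint S V
      · obtain ⟨i, s, hs, hxs⟩ := mem_castleFootprint.1 hxS
        exact Or.inl (mem_castleFootprint.2 ⟨i, s, Finset.mem_filter.2 ⟨hs, x, hxs, hx⟩, hxs⟩)
      · exact Or.inr ⟨hRO hxS, hCU hx⟩
    · exact Or.inl hx.1
  -- The closed set C ∪ W \ O and its open neighbourhood W ∪ O ∩ U differ only inside O, so any
  -- collar inserted between them has small measure.
  obtain ⟨I, hIo, hEI, hIU⟩ := normal_exists_closure_subset hE hU' hEU'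
  obtain ⟨B, hBo, hIB, hBU⟩ := normal_exists_closure_subset isClosed_closure hU' hIU
  have hII : I ⊆ interior (closure I) := hIo.subset_interior_iff.2 subset_closure
  refine ⟨closure I, B, isClosed_closure, hBo, hIB,
    (Set.subset_union_left.trans hEI).trans hII,
    hBU.trans (Set.union_subset hWU Set.inter_subset_right), fun μ hp hi => ?_⟩
  refine (measureReal_mono ?_).trans (hηR μ hp hi)
  rintro x ⟨hxB, hxI⟩
  refine Metric.thickening_subset_cthickening _ _ ?_
  rcases hBU hxB with hxW | hxO
  · by_contra hxO
    exact hxI (hII (hEI (Or.inr ⟨hxW, hxO⟩)))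
  · exact hxO.1

/-- Iterating the collar with errors 1/(n+1) gives increasing closed sets inside decreasing open
ones. The union of the interiors of the closed sets has its frontier in every collar. -/
theorem AlmostFinite.exists_isOpen_null_frontier (h : AlmostFinite Γ X) {C U : Set X}
    (hC : IsClosed C) (hU : IsOpen U) (hCU : C ⊆ U) :
    ∃ W : Set X, IsOpen W ∧ C ⊆ W ∧ W ⊆ U ∧
      ∀ μ : Measure X, IsProbabilityMeasure μ → SMulInvariantMeasure Γ X μ →
        μ.real (frontier W) = 0 := by
  let σ := {p : Set X × Set X // IsClosed p.1 ∧ IsOpen p.2 ∧ p.1 ⊆ p.2}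
  have hstep : ∀ (p : σ) (n : ℕ), ∃ q : σ, p.1.1 ⊆ interior q.1.1 ∧ closure q.1.2 ⊆ p.1.2 ∧
      ∀ μ : Measure X, IsProbabilityMeasure μ → SMulInvariantMeasure Γ X μ →
        μ.real (closure q.1.2 \ interior q.1.1) ≤ 1 / ((n : ℝ) + 1) := by
    intro p n
    obtain ⟨A, B, hA, hB, hAB, h1, h2, h3⟩ := h.exists_small_collar p.2.1 p.2.2.1 p.2.2.2
      (Nat.one_div_pos_of_nat (n := n) (α := ℝ))
    exact ⟨⟨(A, B), hA, hB, hAB⟩, h1, h2, h3⟩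
  choose next hn1 hn2 hn3 using hstep
  let f : ℕ → σ := fun n => Nat.rec ⟨(C, U), hC, hU, hCU⟩ (fun n p => next p n) n
  have hmono : Monotone fun n => (f n).1.1 :=
    monotone_nat_of_le_succ fun n => (hn1 (f n) n).trans interior_subset
  have hanti : Antitone fun n => (f n).1.2 :=
    antitone_nat_of_succ_le fun n => subset_closure.trans (hn2 (f n) n)
  have hcross : ∀ m n, (f m).1.1 ⊆ (f n).1.2 := fun m n =>
    (hmono (le_max_left m n)).trans ((f (max m n)).2.2.2.trans (hanti (le_max_right m n)))
  refine ⟨⋃ n, interior (f n).1.1, isOpen_iUnion fun n => isOpen_interior, ?_, ?_, ?_⟩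
  · exact (hn1 (f 0) 0).trans (Set.subset_iUnion (fun n => interior (f n).1.1) 1)
  · exact Set.iUnion_subset fun n => interior_subset.trans (hcross n 0)
  · intro μ hp hi
    have hle : ∀ n : ℕ, μ.real (frontier (⋃ n, interior (f n).1.1)) ≤ 1 / ((n : ℝ) + 1) := by
      intro n
      refine (measureReal_mono ?_).trans (hn3 (f n) n μ hp hi)
      rw [(isOpen_iUnion fun n => isOpen_interior).frontier_eq]
      refine Set.sdiff_subset_sdiff ?_ (Set.subset_iUnion (fun n => interior (f n).1.1) (n + 1))
      exact closure_mono (Set.iUnion_subset fun m => interior_subset.trans (hcross m (n + 1)))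
    exact le_antisymm (ge_of_tendsto' tendsto_one_div_add_atTop_nhds_zero_nat hle)
      measureReal_nonneg

open Classical in
-- The uniform frequency bound applies with every c > 0 (and empty second set), and one invariant
-- shape then witnesses density at most c.
theorem AlmostFinite.upperDensity_eq_zero (h : AlmostFinite Γ X) {C : Set X} (hC : IsClosed C)
    (hμ : ∀ μ : Measure X, IsProbabilityMeasure μ → SMulInvariantMeasure Γ X μ → μ.real C = 0) :
    upperDensity Γ C = 0 := by
  have hnn : ∀ (F : {F : Finset Γ // F.Nonempty}) (x : X),
      0 ≤ (∑ s ∈ F.1, C.indicator (fun _ => (1 : ℝ)) (s • x)) / (F.1.card : ℝ) := fun F x =>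
    div_nonneg (Finset.sum_nonneg fun s _ => Set.indicator_nonneg (fun _ _ => zero_le_one) _)
      (Nat.cast_nonneg _)
  have hnn' : ∀ F : {F : Finset Γ // F.Nonempty},
      0 ≤ ⨆ x : X, (∑ s ∈ F.1, C.indicator (fun _ => (1 : ℝ)) (s • x)) / (F.1.card : ℝ) :=
    fun F => Real.iSup_nonneg (hnn F)
  refine le_antisymm ?_ (Real.iInf_nonneg hnn')
  refine le_of_forall_pos_le_add fun c hc => ?_
  have hex : ∃ F : {F : Finset Γ // F.Nonempty},
      ⨆ x : X, (∑ s ∈ F.1, C.indicator (fun _ => (1 : ℝ)) (s • x)) / (F.1.card : ℝ) ≤ c := by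
    rcases isEmpty_or_nonempty X with hX | hX
    · exact ⟨⟨{1}, by simp⟩, by simpa using hc.le⟩
    obtain ⟨K, δ, η, ε, hδ, hη, hε, hb⟩ := exists_uniform_frequency_bound (Γ := Γ) hC
      isClosed_empty (c := c) (fun μ hp hi => by simpa [hμ μ hp hi] using hc)
    obtain ⟨F, hF, hinv⟩ := h.exists_invariantShape K hδ
    refine ⟨⟨F, hF⟩, ciSup_le fun x => ?_⟩
    have hcard : (0 : ℝ) < F.card := by exact_mod_cast hF.card_pos
    rw [div_le_iff₀ hcard]
    have h1 := hb F hF hinv x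
    simp only [Metric.cthickening_empty, Set.mem_empty_iff_false, Finset.filter_false,
      Finset.card_empty, Nat.cast_zero, add_zero] at h1
    have h2 : ((F.filter fun s => s • x ∈ C).card : ℝ) ≤
        (F.filter fun s => s • x ∈ Metric.cthickening η C).card := by
      exact_mod_cast Finset.card_le_card (Finset.monotone_filter_right _
        fun s _ hs => Metric.self_subset_cthickening C hs)
    have h3 : ∑ s ∈ F, C.indicator (fun _ => (1 : ℝ)) (s • x) =
        (F.filter fun s => s • x ∈ C).card := by simp [Set.indicator_apply]
    rw [h3]
    nlinarith
  obtain ⟨F, hF⟩ := hex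
  rw [zero_add]
  exact (ciInf_le ⟨0, by rintro _ ⟨F, rfl⟩; exact hnn' F⟩ F).trans hF

theorem AlmostFinite.smallBoundaryProperty (h : AlmostFinite Γ X) :
    SmallBoundaryProperty Γ X := by
  refine ⟨{W | IsOpen W ∧ ∀ μ : Measure X, IsProbabilityMeasure μ → SMulInvariantMeasure Γ X μ →
    μ.real (frontier W) = 0}, ?_, fun U hU => h.upperDensity_eq_zero isClosed_frontier hU.2⟩
  refine TopologicalSpace.isTopologicalBasis_of_isOpen_of_nhds (fun U hU => hU.1) ?_
  intro x U hx hU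
  obtain ⟨W, hWo, hxW, hWU, hW⟩ := h.exists_isOpen_null_frontier isClosed_singleton hU
    (Set.singleton_subset_iff.2 hx)
  exact ⟨W, ⟨hWo, hW⟩, by simpa using hxW, hWU⟩

end SmallBoundary

/-! ### Lifting shapes from H to G by coset representatives. -/

section Lift

variable {G : Type*} [Group G] {H : Subgroup G}

theorem out_mul_inj {q q' : G ⧸ H} {h h' : H} (e : q.out * (h : G) = q'.out * (h' : G)) :
    q = q' ∧ h = h' := by
  have hq : q = q' := by
    rw [← QuotientGroup.out_eq' q, ← QuotientGroup.out_eq' q',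
      ← QuotientGroup.mk_mul_of_mem q.out h.2, e, QuotientGroup.mk_mul_of_mem _ h'.2]
  subst hq
  exact ⟨rfl, Subtype.ext (mul_left_cancel e)⟩

/-- The component in `H` of an element of `G` written as a coset representative times an element
of `H`. -/
def subgroupPart (H : Subgroup G) (g : G) : H :=
  ⟨(g : G ⧸ H).out⁻¹ * g, QuotientGroup.eq.1 (QuotientGroup.out_eq' _)⟩

theorem out_mul_subgroupPart (g : G) : (g : G ⧸ H).out * (subgroupPart H g : G) = g := by
  simp [subgroupPart]

variable [Fintype (G ⧸ H)]

/-- The product of the set of coset representatives with a finite subset of `H`. -/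
def liftShape (S : Finset H) : Finset G :=
  ((Finset.univ : Finset (G ⧸ H)) ×ˢ S).map
    ⟨fun p => p.1.out * (p.2 : G), fun _ _ e => Prod.ext (out_mul_inj e).1 (out_mul_inj e).2⟩

theorem mem_liftShape {S : Finset H} {g : G} :
    g ∈ liftShape S ↔ ∃ q : G ⧸ H, ∃ s ∈ S, q.out * (s : G) = g := by
  rw [liftShape, Finset.mem_map]
  constructor
  · rintro ⟨⟨q, s⟩, hqs, e⟩
    exact ⟨q, s, (Finset.mem_product.1 hqs).2, e⟩
  · rintro ⟨q, s, hs, e⟩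
    exact ⟨(q, s), Finset.mem_product.2 ⟨Finset.mem_univ _, hs⟩, e⟩

theorem out_mul_mem_liftShape {S : Finset H} {q : G ⧸ H} {h : H} :
    q.out * (h : G) ∈ liftShape S ↔ h ∈ S := by
  rw [mem_liftShape]
  constructor
  · rintro ⟨q', s, hs, e⟩
    exact (out_mul_inj e).2 ▸ hs
  · exact fun hh => ⟨q, h, hh, rfl⟩

theorem card_liftShape (S : Finset H) :
    (liftShape S).card = Fintype.card (G ⧸ H) * S.card := by
  simp [liftShape]

/-- Lifts of sufficiently invariant subsets of `H` are as invariant as one likes. -/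
theorem exists_isInvariantShape_liftShape (H : Subgroup G) [Fintype (G ⧸ H)] (L : Finset G) :
    ∃ K : Finset H, ∀ (δ : ℝ) (S : Finset H), IsInvariantShape K δ S →
      IsInvariantShape L δ (liftShape S) := by
  classical
  refine ⟨(L ×ˢ (Finset.univ : Finset (G ⧸ H))).image fun p => subgroupPart H (p.1 * p.2.out),
    fun δ S hS => ?_⟩
  set K := (L ×ˢ (Finset.univ : Finset (G ⧸ H))).image
    fun p => subgroupPart H (p.1 * p.2.out) with hK
  -- Left multiplication by k changes the representative and multiplies the H-part by an element
  -- depending only on k and q. These finitely many elements form K, so the L-boundary of the lift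
  -- consists of representatives times the K-boundary of S.
  have hdec : ∀ (k : G) (q : G ⧸ H) (h : H), k * (q.out * (h : G)) ∈ liftShape S ↔
      subgroupPart H (k * q.out) * h ∈ S := by
    intro k q h
    rw [← out_mul_mem_liftShape (q := ((k * q.out : G) : G ⧸ H)), Subgroup.coe_mul, ← mul_assoc,
      ← mul_assoc, out_mul_subgroupPart]
  have hsub : kBoundary L (liftShape S) ⊆
      (fun p : (G ⧸ H) × H => p.1.out * (p.2 : G)) '' (Set.univ ×ˢ kBoundary K S) := by
    rintro g ⟨⟨k, hk, hkg⟩, ⟨l, hl, hlg⟩⟩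
    rw [← out_mul_subgroupPart (H := H) g, hdec] at hkg hlg
    refine ⟨((g : G ⧸ H), subgroupPart H g), ⟨trivial, ⟨_, ?_, hkg⟩, ⟨_, ?_, hlg⟩⟩,
      out_mul_subgroupPart g⟩
    · exact Finset.mem_image.2 ⟨(k, (g : G ⧸ H)), by simp [hk], rfl⟩
    · exact Finset.mem_image.2 ⟨(l, (g : G ⧸ H)), by simp [hl], rfl⟩
  have hfin : ((Set.univ : Set (G ⧸ H)) ×ˢ kBoundary K S).Finite :=
    Set.finite_univ.prod (kBoundary_finite K S)
  have hle : (kBoundary L (liftShape S)).ncard ≤ Fintype.card (G ⧸ H) * (kBoundary K S).ncard := by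
    refine (Set.ncard_le_ncard hsub (hfin.image _)).trans ((Set.ncard_image_le hfin).trans ?_)
    rw [Set.ncard_prod, Set.ncard_univ, Nat.card_eq_fintype_card]
  have hle' : ((kBoundary L (liftShape S)).ncard : ℝ) ≤
      Fintype.card (G ⧸ H) * (kBoundary K S).ncard := by exact_mod_cast hle
  unfold IsInvariantShape at *
  rw [card_liftShape]
  push_cast
  calc _ ≤ _ := hle'
    _ ≤ (Fintype.card (G ⧸ H) : ℝ) * (δ * S.card) := by gcongr
    _ = _ := by ring

end Lift

/-! ### Cutting bases so that lifted shapes still give towers. -/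

section Refine

/-- By freeness the continuous function x ↦ dist (g x) x is positive for g ≠ 1, so by compactness it
is bounded away from 0. -/
theorem exists_displacement {G X : Type*} [Group G] [MetricSpace X] [CompactSpace X]
    [MulAction G X] [ContinuousConstSMul G X] (hfree : ∀ (g : G) (x : X), g • x = x → g = 1)
    (E : Finset G) : ∃ ρ : ℝ, 0 < ρ ∧ ∀ g ∈ E, g ≠ 1 → ∀ x : X, ρ ≤ dist (g • x) x := by
  classical
  induction E using Finset.induction_on with
  | empty => exact ⟨1, one_pos, by simp⟩
  | insert a E _ ih =>
    obtain ⟨ρ, hρ, h⟩ := ih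
    by_cases ha : a = 1
    · refine ⟨ρ, hρ, fun g hg hg1 => ?_⟩
      rcases Finset.mem_insert.1 hg with rfl | hg
      · exact absurd ha hg1
      · exact h g hg hg1
    obtain ⟨r, hr, hrx⟩ := isCompact_univ.exists_forall_le' (f := fun x : X => dist (a • x) x)
      ((continuous_const_smul a).dist continuous_id).continuousOn (a := 0)
      (fun x _ => dist_pos.2 fun e => ha (hfree a x e))
    refine ⟨min ρ r, lt_min hρ hr, fun g hg hg1 x => ?_⟩
    rcases Finset.mem_insert.1 hg with rfl | hg
    · exact (min_le_right _ _).trans (hrx x trivial)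
    · exact (min_le_left _ _).trans (h g hg hg1 x)

/-- Up to a set which is null for all invariant measures, the space is a disjoint union of finitely
many open sets of small diameter. -/
theorem AlmostFinite.exists_small_cells {Γ X : Type*} [Group Γ] [MulAction Γ X] [MetricSpace X]
    [CompactSpace X] [MeasurableSpace X] [BorelSpace X] [ContinuousConstSMul Γ X]
    (h : AlmostFinite Γ X) {ρ : ℝ} (hρ : 0 < ρ) :
    ∃ (m : ℕ) (D : Fin m → Set X), (∀ l, IsOpen (D l)) ∧
      (∀ l, ∀ x ∈ D l, ∀ y ∈ D l, dist x y < ρ) ∧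
      (∀ l l' x, x ∈ D l → x ∈ D l' → l = l') ∧
      ∀ μ : Measure X, IsProbabilityMeasure μ → SMulInvariantMeasure Γ X μ →
        μ.real (⋃ l, D l)ᶜ = 0 := by
  choose W hWo hxW hWb hW using fun x : X => h.exists_isOpen_null_frontier
    (isClosed_singleton (x := x)) (Metric.isOpen_ball (x := x) (ε := ρ / 2))
    (Set.singleton_subset_iff.2 (Metric.mem_ball_self (half_pos hρ)))
  obtain ⟨t, ht⟩ := isCompact_univ.elim_finite_subcover W hWo
    (fun x _ => Set.mem_iUnion.2 ⟨x, hxW x rfl⟩)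
  let e := t.equivFin.symm
  let Y : Fin t.card → Set X := fun l => W (e l)
  have hYcov : ∀ x, ∃ l, x ∈ Y l := fun x => by
    obtain ⟨y, hy, hxy⟩ := Set.mem_iUnion₂.1 (ht (Set.mem_univ x))
    exact ⟨e.symm ⟨y, hy⟩, by simpa [Y] using hxy⟩
  refine ⟨t.card, fun l => Y l \ ⋃ l' ∈ Set.Iio l, closure (Y l'), fun l => ?_, ?_, ?_, ?_⟩
  · exact (hWo _).sdiff ((Set.finite_Iio l).isClosed_biUnion fun _ _ => isClosed_closure)
  · intro l x hx y hy
    have h1 := Metric.mem_ball.1 (hWb _ hx.1)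
    have h2 := Metric.mem_ball.1 (hWb _ hy.1)
    exact (dist_triangle_right x y (e l : X)).trans_lt (by linarith)
  · intro l l' x hx hx'
    rcases lt_trichotomy l l' with hlt | heq | hlt
    · exact absurd (Set.mem_biUnion (Set.mem_Iio.2 hlt) (subset_closure hx.1)) hx'.2
    · exact heq
    · exact absurd (Set.mem_biUnion (Set.mem_Iio.2 hlt) (subset_closure hx'.1)) hx.2
  · intro μ hp hi
    refine le_antisymm ?_ measureReal_nonneg
    have hsub : (⋃ l, (Y l \ ⋃ l' ∈ Set.Iio l, closure (Y l')))ᶜ ⊆ ⋃ l, frontier (Y l) := by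
      intro x hx
      -- For the least l with x in the closure of Y l, either x is on the frontier of Y l or x lies
      -- in the l-th cell.
      obtain ⟨l, hl, hmin⟩ := WellFounded.has_min (wellFounded_lt (α := Fin t.card))
        {l | x ∈ closure (Y l)} ((hYcov x).imp fun l hl => subset_closure hl)
      refine Set.mem_iUnion.2 ⟨l, ?_⟩
      rw [(hWo _).frontier_eq]
      refine ⟨hl, fun hxl => hx (Set.mem_iUnion.2 ⟨l, hxl, ?_⟩)⟩
      intro hx'
      obtain ⟨l', hl', hxl'⟩ := Set.mem_iUnion₂.1 hx'
      exact hmin l' hxl' hl'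
    calc _ ≤ μ.real (⋃ l, frontier (Y l)) := measureReal_mono hsub
      _ ≤ ∑ l, μ.real (frontier (Y l)) := measureReal_iUnion_fintype_le _
      _ = 0 := Finset.sum_eq_zero fun l _ => hW _ μ hp hi

instance subgroup_continuousConstSMul {G X : Type*} [Group G] (H : Subgroup G)
    [TopologicalSpace X] [MulAction G X] [ContinuousConstSMul G X] :
    ContinuousConstSMul H X :=
  ⟨fun h => continuous_const_smul (h : G)⟩

variable {G X : Type*} [Group G] {H : Subgroup G} [Fintype (G ⧸ H)]
  [MetricSpace X] [CompactSpace X] [MeasurableSpace X] [BorelSpace X]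
  [MulAction G X] [ContinuousConstSMul G X]

/-- Castles of the subgroup whose towers extend to towers of the whole group. -/
theorem AlmostFinite.exists_castle_liftShape
    (hfree : ∀ (g : G) (x : X), g • x = x → g = 1) (h : AlmostFinite H X)
    (K : Finset H) {δ ε : ℝ} (hδ : 0 < δ) (hε : 0 < ε) :
    ∃ (k : ℕ) (S : Fin k → Finset H) (V : Fin k → Set X),
      IsOpenCastle S V ∧ (∀ i, IsInvariantShape K δ (S i)) ∧
      (∀ i, IsTower (liftShape (S i)) (V i)) ∧
      ∀ μ : Measure X, IsProbabilityMeasure μ → SMulInvariantMeasure H X μ →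
        μ.real (castleFootprint S V)ᶜ ≤ ε := by
  classical
  obtain ⟨k, S, V, hc, hinv, -, hR⟩ := h.exists_castle K hδ hε
  obtain ⟨ρ, hρ, hdisp⟩ := exists_displacement (X := X) hfree
    (Finset.univ.biUnion fun i => (liftShape (S i))⁻¹ * liftShape (S i))
  obtain ⟨m, D, hDo, hDd, hDdisj, hDnull⟩ := h.exists_small_cells hρ
  let e : Fin (k * m) ≃ Fin k × Fin m := finProdFinEquiv.symm
  refine ⟨k * m, fun a => S (e a).1, fun a => V (e a).1 ∩ D (e a).2, ⟨?_, ?_⟩, fun a => hinv _,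
    ?_, ?_⟩
  · refine IsCastle.of_eq_of_mem fun a b s hs t ht x hx hx' => ?_
    rw [Set.smul_set_inter] at hx hx'
    obtain ⟨h1, rfl⟩ := hc.castle.eq_of_mem hs ht hx.1 hx'.1
    refine ⟨e.injective (Prod.ext h1 ?_), rfl⟩
    exact hDdisj _ _ _ (Set.mem_smul_set_iff_inv_smul_mem.1 hx.2)
      (Set.mem_smul_set_iff_inv_smul_mem.1 hx'.2)
  · exact fun a => (hc.isOpen _).inter (hDo _)
  · intro a g hg g' hg' hne
    refine Set.disjoint_left.2 fun x hx hx' => ?_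
    have hy := (Set.mem_smul_set_iff_inv_smul_mem.1 hx).2
    have hz := (Set.mem_smul_set_iff_inv_smul_mem.1 hx').2
    -- A common point of two levels gives two points of one cell, closer than ρ, that differ by a
    -- nontrivial element of the finite set displacing all points by at least ρ.
    have h1 := hDd _ _ hz _ hy
    have h2 := hdisp (g'⁻¹ * g) (Finset.mem_biUnion.2 ⟨(e a).1, Finset.mem_univ _,
      Finset.mul_mem_mul (Finset.inv_mem_inv hg') hg⟩)
      (fun h0 => hne (inv_mul_eq_one.1 h0).symm) (g⁻¹ • x)
    rw [mul_smul, smul_inv_smul] at h2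
    linarith
  · intro μ hp hi
    have hsub : (castleFootprint (fun a => S (e a).1) fun a => V (e a).1 ∩ D (e a).2)ᶜ ⊆
        (castleFootprint S V)ᶜ ∪ castleFootprint S fun _ => (⋃ l, D l)ᶜ := by
      intro x hx
      by_cases hxS : x ∈ castleFootprint S V
      · right
        obtain ⟨i, s, hs, hxs⟩ := mem_castleFootprint.1 hxS
        refine mem_castleFootprint.2 ⟨i, s, hs, Set.mem_smul_set_iff_inv_smul_mem.2 fun hxD => ?_⟩
        obtain ⟨l, hl⟩ := Set.mem_iUnion.1 hxD
        refine hx (mem_castleFootprint.2 ⟨e.symm (i, l), s, by simpa using hs, ?_⟩)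
        rw [Set.smul_set_inter]
        simpa using ⟨hxs, Set.mem_smul_set_iff_inv_smul_mem.2 hl⟩
      · exact Or.inl hxS
    have h1 := measureReal_castleFootprint_le (μ := μ) S fun _ => (⋃ l, D l)ᶜ
    simp only [hDnull μ hp hi, mul_zero, Finset.sum_const_zero] at h1
    have h2 := (measureReal_mono (μ := μ) hsub).trans (measureReal_union_le _ _)
    linarith [hR μ hp hi]

end Refine

/-! ### Fine tiles inside coarse regions, with priority to smaller indices. -/

section JointCastle

variable {G X : Type*} [Group G] {H : Subgroup G} [Fintype (G ⧸ H)] [MulAction G X]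
  [TopologicalSpace X] {k l : ℕ}

/-- The points `z ∈ A j` whose lifted tile `liftShape (P j) z` lies in the region
`liftShape (S i) x` of a point `x ∈ V i` of the orbit of `z` under `H`, and away from the regions
with index below `i`. -/
def jointBase (P : Fin l → Finset H) (A : Fin l → Set X) (S : Fin k → Finset H)
    (V : Fin k → Set X) (i : Fin k) (j : Fin l) : Set X :=
  {z | z ∈ A j ∧ (∃ h : H, h⁻¹ • z ∈ V i ∧ ∀ p ∈ P j, p * h ∈ S i) ∧
    ∀ g ∈ liftShape (P j), ∀ i' < i, g • z ∉ closure (towerFootprint (liftShape (S i')) (V i'))}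

variable {P : Fin l → Finset H} {A : Fin l → Set X} {S : Fin k → Finset H} {V : Fin k → Set X}

/-- This is why `jointBase` excludes the closures of the earlier regions and not merely the regions.
-/
theorem isOpen_jointBase [ContinuousConstSMul G X] (hA : ∀ j, IsOpen (A j))
    (hV : ∀ i, IsOpen (V i)) (i : Fin k) (j : Fin l) : IsOpen (jointBase P A S V i j) := by
  have h2 : IsOpen {z : X | ∃ h : H, h⁻¹ • z ∈ V i ∧ ∀ p ∈ P j, p * h ∈ S i} := by
    have : {z : X | ∃ h : H, h⁻¹ • z ∈ V i ∧ ∀ p ∈ P j, p * h ∈ S i} =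
        ⋃ h ∈ {h : H | ∀ p ∈ P j, p * h ∈ S i}, h • V i := by
      ext z
      simp only [Set.mem_iUnion, Set.mem_smul_set_iff_inv_smul_mem, exists_prop]
      exact exists_congr fun h => and_comm
    rw [this]
    exact isOpen_biUnion fun h _ => (hV i).smul h
  have h3 : IsOpen {z : X | ∀ g ∈ liftShape (P j), ∀ i' < i,
      g • z ∉ closure (towerFootprint (liftShape (S i')) (V i'))} := by
    have : {z : X | ∀ g ∈ liftShape (P j), ∀ i' < i,
        g • z ∉ closure (towerFootprint (liftShape (S i')) (V i'))} =
        ⋂ g ∈ (liftShape (P j) : Set G), ⋂ i' ∈ Set.Iio i, (fun z => g • z) ⁻¹'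
          (closure (towerFootprint (liftShape (S i')) (V i')))ᶜ := by
      ext z
      simp
    rw [this]
    exact (Finset.finite_toSet _).isOpen_biInter fun g _ =>
      (Set.finite_Iio i).isOpen_biInter fun i' _ =>
        isClosed_closure.isOpen_compl.preimage (continuous_const_smul g)
  exact (hA j).inter (h2.inter h3)

/-- A point of a level lies in its own coarse region, so the priority rule forces i = i'. The coarse
tower then identifies the coset and the position in H, which reduces the claim to the fine castle of
H. -/
theorem jointBase_levels_eq (hA : IsCastle P A)
    (hVG : ∀ i, IsTower (liftShape (S i)) (V i)) {i i' : Fin k} {j j' : Fin l} {g g' : G}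
    (hg : g ∈ liftShape (P j)) (hg' : g' ∈ liftShape (P j')) {x : X}
    (hx : x ∈ g • jointBase P A S V i j) (hx' : x ∈ g' • jointBase P A S V i' j') :
    i = i' ∧ j = j' ∧ g = g' := by
  obtain ⟨z, ⟨hzA, ⟨h, hzV, hPS⟩, hzlow⟩, rfl⟩ := hx
  obtain ⟨z', ⟨hzA', ⟨h', hzV', hPS'⟩, hzlow'⟩, hzz⟩ := hx'
  replace hzz : g' • z' = g • z := hzz
  obtain ⟨q, p, hp, rfl⟩ := mem_liftShape.1 hg
  obtain ⟨q', p', hp', rfl⟩ := mem_liftShape.1 hg'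
  have e1 : ((q.out * ((p * h : H) : G)) • (h⁻¹ • z) : X) = (q.out * (p : G)) • z := by
    simp [mul_smul, Subgroup.smul_def]
  have e2 : ((q'.out * ((p' * h' : H) : G)) • (h'⁻¹ • z') : X) = (q'.out * (p' : G)) • z' := by
    simp [mul_smul, Subgroup.smul_def]
  have m1 : (q.out * (p : G)) • z ∈ (q.out * ((p * h : H) : G)) • V i := by
    rw [← e1]; exact Set.smul_mem_smul_set hzV
  have m2 : (q.out * (p : G)) • z ∈ (q'.out * ((p' * h' : H) : G)) • V i' := by
    rw [← hzz, ← e2]; exact Set.smul_mem_smul_set hzV'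
  have s1 : q.out * ((p * h : H) : G) ∈ liftShape (S i) := out_mul_mem_liftShape.2 (hPS p hp)
  have s2 : q'.out * ((p' * h' : H) : G) ∈ liftShape (S i') :=
    out_mul_mem_liftShape.2 (hPS' p' hp')
  have hii : i = i' := by
    rcases lt_trichotomy i i' with hlt | heq | hlt
    · refine absurd (subset_closure (mem_towerFootprint.2 ⟨_, s1, m1⟩)) ?_
      rw [← hzz]
      exact hzlow' _ hg' i hlt
    · exact heq
    · exact absurd (subset_closure (mem_towerFootprint.2 ⟨_, s2, m2⟩)) (hzlow _ hg i' hlt)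
  subst hii
  have hgh : q.out * ((p * h : H) : G) = q'.out * ((p' * h' : H) : G) := by
    by_contra hne
    exact Set.disjoint_left.1 (hVG i s1 s2 hne) m1 m2
  obtain ⟨rfl, hph⟩ := out_mul_inj hgh
  have hpz : p' • z' = p • z := by
    rw [mul_smul, mul_smul] at hzz
    exact smul_left_cancel _ hzz
  obtain ⟨rfl, rfl⟩ := hA.eq_of_mem (x := p • z) hp hp' (Set.smul_mem_smul_set hzA)
    (hpz ▸ Set.smul_mem_smul_set hzA')
  exact ⟨rfl, rfl, rfl⟩

/-- For the H-castle itself, closing a tower adds only points of the remainder; the representatives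
act by homeomorphisms and there are finitely many. This bounds the cost of excluding closures. -/
theorem closure_towerFootprint_liftShape_subset [ContinuousConstSMul G X]
    (hV : IsOpenCastle S V) (i : Fin k) :
    closure (towerFootprint (liftShape (S i)) (V i)) ⊆
      towerFootprint (liftShape (S i)) (V i) ∪
        ⋃ q : G ⧸ H, q.out • (castleFootprint S V)ᶜ := by
  classical
  have h1 : towerFootprint (liftShape (S i)) (V i) =
      ⋃ q : G ⧸ H, q.out • towerFootprint (S i) (V i) := by
    ext x
    simp only [mem_towerFootprint, Set.mem_iUnion, Set.mem_smul_set_iff_inv_smul_mem,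
      mem_liftShape]
    constructor
    · rintro ⟨_, ⟨q, s, hs, rfl⟩, hx⟩
      exact ⟨q, s, hs, by simpa [mul_smul, Subgroup.smul_def] using hx⟩
    · rintro ⟨q, s, hs, hx⟩
      exact ⟨_, ⟨q, s, hs, rfl⟩, by simpa [mul_smul, Subgroup.smul_def] using hx⟩
  have h2 : closure (towerFootprint (S i) (V i)) ⊆
      towerFootprint (S i) (V i) ∪ (castleFootprint S V)ᶜ := by
    have := hV.closure_levels_subset (fun i' => if i' = i then S i' else ∅)
      (fun i' => by split_ifs <;> simp)
    have h3 : castleFootprint (fun i' => if i' = i then S i' else ∅) V =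
        towerFootprint (S i) (V i) := by
      ext x
      simp only [mem_castleFootprint, mem_towerFootprint]
      constructor
      · rintro ⟨i', s, hs, hx⟩
        split_ifs at hs with hi
        · subst hi; exact ⟨s, hs, hx⟩
        · simp at hs
      · rintro ⟨s, hs, hx⟩
        exact ⟨i, s, by simpa using hs, hx⟩
    rwa [h3] at this
  rw [h1, closure_iUnion_of_finite]
  refine Set.iUnion_subset fun q => ?_
  rw [closure_smul]
  refine (Set.smul_set_mono h2).trans ?_
  rw [Set.smul_set_union]
  exact Set.union_subset_union (Set.subset_iUnion_of_subset q subset_rfl)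
    (Set.subset_iUnion_of_subset q subset_rfl)

/-- The points that are not covered by the joint castle. -/
theorem mem_of_notMem_jointBase [ContinuousConstSMul G X] (hV : IsOpenCastle S V)
    {L : Finset G} (hL1 : (1 : G) ∈ L)
    (hL : ∀ j, ∀ g ∈ liftShape (P j), ∀ g' ∈ liftShape (P j), g' * g⁻¹ ∈ L) {y : X}
    (hy : ∀ i j, ∀ g ∈ liftShape (P j), y ∉ g • jointBase P A S V i j) :
    y ∈ (⋃ q : G ⧸ H, q.out • (castleFootprint P A)ᶜ) ∪
      (castleFootprint (fun i => (kBoundary_finite L (liftShape (S i))).toFinset) V ∪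
        ⋃ g ∈ L, ⋃ q : G ⧸ H, g⁻¹ • q.out • (castleFootprint S V)ᶜ) := by
  by_contra hcon
  simp only [Set.mem_union, not_or] at hcon
  -- The bad sets are translates of the fine remainder, points on the L-boundary of a coarse region,
  -- and points that L moves into a translate of the coarse remainder.
  obtain ⟨n1, n2, n3⟩ := hcon
  have n3' : ∀ g ∈ L, ∀ q : G ⧸ H, g • y ∉ q.out • (castleFootprint S V)ᶜ := fun g hg q hgy =>
    n3 (Set.mem_iUnion₂.2 ⟨g, hg, Set.mem_iUnion.2 ⟨q,
      Set.mem_smul_set_iff_inv_smul_mem.2 (by simpa using hgy)⟩⟩)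
  have n2' : ∀ (i : Fin k) (g : G), g⁻¹ • y ∈ V i → g ∉ kBoundary L (liftShape (S i)) :=
    fun i g hg hgb => n2 (mem_castleFootprint.2 ⟨i, g, by simpa using hgb,
      Set.mem_smul_set_iff_inv_smul_mem.2 hg⟩)
  have hex : ∃ i, y ∈ towerFootprint (liftShape (S i)) (V i) := by
    have h1 := n3' 1 hL1 ((1 : G) : G ⧸ H)
    rw [one_smul, Set.mem_smul_set_iff_inv_smul_mem, Set.mem_compl_iff, not_not] at h1
    obtain ⟨i, s, hs, hx⟩ := mem_castleFootprint.1 h1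
    refine ⟨i, mem_towerFootprint.2 ⟨_, (out_mul_mem_liftShape (q := ((1 : G) : G ⧸ H))).2 hs, ?_⟩⟩
    rw [mul_smul, Set.mem_smul_set_iff_inv_smul_mem]
    exact hx
  -- The tile through y is tested against the first coarse region containing y.
  obtain ⟨i, hi, hmin⟩ := WellFounded.has_min (wellFounded_lt (α := Fin k))
    {i | y ∈ towerFootprint (liftShape (S i)) (V i)} hex
  obtain ⟨_, hgS, hyi⟩ := mem_towerFootprint.1 hi
  obtain ⟨q, s, hs, rfl⟩ := mem_liftShape.1 hgS
  rw [Set.mem_smul_set_iff_inv_smul_mem] at hyi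
  have h1 : q.out⁻¹ • y ∈ castleFootprint P A := by
    by_contra hn
    exact n1 (Set.mem_iUnion.2 ⟨q, Set.mem_smul_set_iff_inv_smul_mem.2 hn⟩)
  obtain ⟨j, p, hp, hz⟩ := mem_castleFootprint.1 h1
  rw [Set.mem_smul_set_iff_inv_smul_mem] at hz
  have hpl : q.out * (p : G) ∈ liftShape (P j) := out_mul_mem_liftShape.2 hp
  have hzy : (q.out * (p : G)) • (p⁻¹ • q.out⁻¹ • y : X) = y := by
    simp [mul_smul, Subgroup.smul_def]
  refine hy i j _ hpl ?_
  rw [← hzy]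
  refine Set.smul_mem_smul_set ⟨hz, ⟨p⁻¹ * s, ?_, fun p' hp' => ?_⟩, fun g hg i' hi' hcl => ?_⟩
  · simpa [mul_smul, Subgroup.smul_def] using hyi
  -- If the tile left the region, L would move the position of y out of the lifted shape, putting it
  -- on the L-boundary.
  · by_contra hn
    refine n2' i _ hyi ⟨⟨1, hL1, by simpa using hgS⟩,
      ⟨_, hL j _ hpl _ ((out_mul_mem_liftShape (q := q)).2 hp'), fun hmem => hn ?_⟩⟩
    refine (out_mul_mem_liftShape (q := q)).1 ?_
    convert hmem using 1
    push_cast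
    group
  · have hlL := hL j _ hpl g hg
    have hgz : g • (p⁻¹ • q.out⁻¹ • y : X) = (g * (q.out * (p : G))⁻¹) • y := by
      rw [mul_smul]
      congr 1
      rw [eq_inv_smul_iff, hzy]
    rw [hgz] at hcl
    -- If the tile entered an earlier region, y would be on the L-boundary of that region, because
    -- by minimality y is not in it. The other points of the closure belong to the third bad set.
    rcases closure_towerFootprint_liftShape_subset hV i' hcl with hin | hout
    · obtain ⟨g', hg', hyg'⟩ := mem_towerFootprint.1 hin
      rw [Set.mem_smul_set_iff_inv_smul_mem] at hyg'
      set m := g * (q.out * (p : G))⁻¹ with hm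
      have hw : (m⁻¹ * g')⁻¹ • y ∈ V i' := by simpa [mul_smul] using hyg'
      refine n2' i' _ hw ⟨⟨m, hlL, by simpa using hg'⟩, ⟨1, hL1, fun hmem => ?_⟩⟩
      rw [one_mul] at hmem
      exact hmin i' (mem_towerFootprint.2 ⟨_, hmem, Set.mem_smul_set_iff_inv_smul_mem.2 hw⟩) hi'
    · obtain ⟨q', hq'⟩ := Set.mem_iUnion.1 hout
      exact n3' _ hlL q' hq'

end JointCastle

/-! ### Castles for G with small remainder. -/

section Castle

variable {G X : Type*} [Group G] {H : Subgroup G} [Fintype (G ⧸ H)]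
  [MetricSpace X] [CompactSpace X] [MulAction G X] [ContinuousConstSMul G X]

/-- The finitely many representatives are uniformly continuous together, as one map into a finite
power of the compact space X. -/
theorem exists_diam_out_smul_lt {δ : ℝ} (hδ : 0 < δ) :
    ∃ η : ℝ, 0 < η ∧ ∀ (q : G ⧸ H) (A : Set X), Metric.diam A < η →
      Metric.diam (q.out • A) < δ := by
  have huc : UniformContinuous fun (x : X) (q : G ⧸ H) => q.out • x :=
    CompactSpace.uniformContinuous_of_continuous
      (continuous_pi fun q => continuous_const_smul q.out)
  obtain ⟨η, hη, h⟩ := Metric.uniformContinuous_iff.1 huc (δ / 2) (half_pos hδ)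
  refine ⟨η, hη, fun q A hA => ?_⟩
  refine (Metric.diam_le_of_forall_dist_le (half_pos hδ).le ?_).trans_lt (half_lt_self hδ)
  rintro _ ⟨a, ha, rfl⟩ _ ⟨b, hb, rfl⟩
  have hab : dist a b < η :=
    (Metric.dist_le_diam_of_mem Metric.isBounded_of_compactSpace ha hb).trans_lt hA
  exact ((dist_pi_lt_iff (half_pos hδ)).1 (h hab) q).le

variable [MeasurableSpace X] [BorelSpace X]

/-- If the restriction of a free action to a subgroup of finite index is almost finite, the action
has castles whose complement is small for all invariant measures. -/
theorem AlmostFinite.exists_castle_of_finiteIndex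
    (hfree : ∀ (g : G) (x : X), g • x = x → g = 1) (h : AlmostFinite H X)
    (K : Finset G) {δ ε : ℝ} (hδ : 0 < δ) (hε : 0 < ε) :
    ∃ (k : ℕ) (S : Fin k → Finset G) (V : Fin k → Set X),
      IsOpenCastle S V ∧ (∀ i, IsInvariantShape K δ (S i)) ∧
      (∀ i, ∀ s ∈ S i, Metric.diam (s • V i) < δ) ∧
      ∀ μ : Measure X, IsProbabilityMeasure μ → SMulInvariantMeasure G X μ →
        μ.real (castleFootprint S V)ᶜ ≤ ε := by
  classical
  set n : ℝ := ((Fintype.card (G ⧸ H) : ℕ) : ℝ) with hn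
  have hn0 : 0 < n := by
    rw [hn]
    exact_mod_cast Fintype.card_pos (α := G ⧸ H)
  obtain ⟨K₁, hK₁⟩ := exists_isInvariantShape_liftShape H K
  obtain ⟨η, hη, hdiam⟩ := exists_diam_out_smul_lt (G := G) (H := H) (X := X) hδ
  obtain ⟨l, P, A, hA, hPinv, hAdiam, hR₁⟩ := h.exists_castle K₁ (δ := min δ η)
    (ε := ε / (3 * n)) (lt_min hδ hη) (by positivity)
  set L : Finset G := insert 1 (Finset.univ.biUnion fun j =>
    liftShape (P j) * (liftShape (P j))⁻¹) with hLdef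
  have hL0 : (0 : ℝ) < L.card := by
    exact_mod_cast Finset.card_pos.2 ⟨1, Finset.mem_insert_self _ _⟩
  have hL : ∀ j, ∀ g ∈ liftShape (P j), ∀ g' ∈ liftShape (P j), g' * g⁻¹ ∈ L :=
    fun j g hg g' hg' => Finset.mem_insert_of_mem (Finset.mem_biUnion.2 ⟨j, Finset.mem_univ _,
      Finset.mul_mem_mul hg' (Finset.inv_mem_inv hg)⟩)
  obtain ⟨K₂, hK₂⟩ := exists_isInvariantShape_liftShape H L
  -- The tolerance absorbs the factor n in the size of a lifted shape, and the remainder bound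
  -- absorbs its n |L| translates; each of the three bad sets gets ε/3.
  obtain ⟨k, S, V, hV, hSinv, hVG, hR₂⟩ := h.exists_castle_liftShape hfree K₂
    (δ := ε / (3 * n)) (ε := ε / (3 * n * L.card)) (by positivity) (by positivity)
  let e : Fin (k * l) ≃ Fin k × Fin l := finProdFinEquiv.symm
  refine ⟨k * l, fun a => liftShape (P (e a).2), fun a => jointBase P A S V (e a).1 (e a).2,
    ⟨?_, fun a => isOpen_jointBase hA.isOpen hV.isOpen _ _⟩, fun a => ?_, fun a g hg => ?_, ?_⟩
  · refine IsCastle.of_eq_of_mem fun a b g hg g' hg' x hx hx' => ?_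
    obtain ⟨h1, h2, h3⟩ := jointBase_levels_eq hA.castle hVG hg hg' hx hx'
    exact ⟨e.injective (Prod.ext h1 h2), h3⟩
  · exact hK₁ δ _ ((hPinv _).mono subset_rfl (min_le_left _ _))
  · obtain ⟨q, p, hp, rfl⟩ := mem_liftShape.1 hg
    rw [mul_smul]
    refine lt_of_le_of_lt (Metric.diam_mono (t := q.out • p • A (e a).2) ?_
      Metric.isBounded_of_compactSpace) (hdiam q _ ((hAdiam _ p hp).trans_le (min_le_right _ _)))
    exact Set.smul_set_mono (Set.smul_set_mono fun z hz => hz.1)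
  · intro μ hp hi
    have hiH : SMulInvariantMeasure H X μ :=
      ⟨fun h _ hs => SMulInvariantMeasure.measure_preimage_smul (h : G) hs⟩
    have hsub : (castleFootprint (fun a => liftShape (P (e a).2))
        fun a => jointBase P A S V (e a).1 (e a).2)ᶜ ⊆ _ := fun y hy =>
      mem_of_notMem_jointBase (P := P) (A := A) hV (Finset.mem_insert_self _ _) hL
        (fun i j g hg hyg => hy (mem_castleFootprint.2 ⟨e.symm (i, j), g, by simpa using hg,
          by simpa using hyg⟩))
    have b1 : μ.real (⋃ q : G ⧸ H, q.out • (castleFootprint P A)ᶜ) ≤ ε / 3 := by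
      refine (measureReal_iUnion_fintype_le _).trans ?_
      simp only [measureReal_smul_set, Finset.sum_const, Finset.card_univ, nsmul_eq_mul]
      calc _ ≤ n * (ε / (3 * n)) := by gcongr; exact hR₁ μ hp hiH
        _ = ε / 3 := by field_simp
    have b2 : μ.real (castleFootprint
        (fun i => (kBoundary_finite L (liftShape (S i))).toFinset) V) ≤ ε / 3 := by
      refine (measureReal_castleFootprint_le _ _).trans ?_
      calc _ ≤ ∑ i, (ε / 3) * ((S i).card * μ.real (V i)) := by
            refine Finset.sum_le_sum fun i _ => ?_
            have h1 := hK₂ _ _ (hSinv i)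
            unfold IsInvariantShape at h1
            rw [Set.ncard_eq_toFinset_card _ (kBoundary_finite L (liftShape (S i))),
              card_liftShape] at h1
            push_cast at h1
            rw [← hn] at h1
            rw [← mul_assoc]
            refine mul_le_mul_of_nonneg_right (h1.trans (le_of_eq ?_)) measureReal_nonneg
            field_simp
        _ = (ε / 3) * ∑ i, ((S i).card * μ.real (V i)) := by rw [Finset.mul_sum]
        _ ≤ (ε / 3) * 1 := by gcongr; exact hV.sum_card_mul_le_one
        _ = ε / 3 := mul_one _
    have b3 : μ.real (⋃ g ∈ L, ⋃ q : G ⧸ H, g⁻¹ • q.out • (castleFootprint S V)ᶜ) ≤ ε / 3 := by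
      refine (measureReal_biUnion_finset_le _ _).trans ?_
      calc _ ≤ ∑ _g ∈ L, n * (ε / (3 * n * L.card)) := by
            refine Finset.sum_le_sum fun g _ => ?_
            refine (measureReal_iUnion_fintype_le _).trans ?_
            simp only [measureReal_smul_set, Finset.sum_const, Finset.card_univ, nsmul_eq_mul]
            gcongr
            exact hR₂ μ hp hiH
        _ = ε / 3 := by
            rw [Finset.sum_const, nsmul_eq_mul]
            field_simp
    have h1 := measureReal_mono (μ := μ) hsub
    have h2 := h1.trans ((measureReal_union_le _ _).trans
      (add_le_add_right (measureReal_union_le _ _) _))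
    linarith

end Castle

/-! ### Averaging invariant measures over cosets. -/

section Average

variable {G X : Type*} [Group G] {H : Subgroup G} [Fintype (G ⧸ H)] [MulAction G X]
  [MeasurableSpace X] [MeasurableConstSMul G X]

/-- Averaging an invariant measure of a subgroup of finite index over the cosets. -/
theorem exists_average (ν : Measure X) [IsProbabilityMeasure ν] [SMulInvariantMeasure H X ν] :
    ∃ μ : Measure X, IsProbabilityMeasure μ ∧ SMulInvariantMeasure G X μ ∧
      ∀ E, MeasurableSet E →
        Fintype.card (G ⧸ H) * μ.real E = ∑ q : G ⧸ H, ν.real (q.out⁻¹ • E) := by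
  have hn : (Fintype.card (G ⧸ H) : ℝ≥0∞) ≠ 0 := by
    simp
  let σ : Measure X := ∑ q : G ⧸ H, ν.map fun x => q.out • x
  have hσ : ∀ E, MeasurableSet E → σ E = ∑ q : G ⧸ H, ν ((fun x => q.out • x) ⁻¹' E) := by
    intro E hE
    rw [Measure.finsetSum_apply]
    exact Finset.sum_congr rfl fun q _ => Measure.map_apply (measurable_const_smul q.out) hE
  refine ⟨(Fintype.card (G ⧸ H) : ℝ≥0∞)⁻¹ • σ, ⟨?_⟩, ⟨fun g E hE => ?_⟩, fun E hE => ?_⟩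
  · rw [Measure.smul_apply, hσ _ MeasurableSet.univ]
    simp [ENNReal.inv_mul_cancel hn]
  · rw [Measure.smul_apply, Measure.smul_apply, hσ _ hE, hσ _ (measurable_const_smul g hE)]
    congr 1
    -- Multiplication by g permutes the cosets, and g times a representative is the new
    -- representative times an element of H, which preserves ν.
    rw [← Equiv.sum_comp (MulAction.toPerm g : Equiv.Perm (G ⧸ H))
      fun q => ν ((fun x => q.out • x) ⁻¹' E)]
    refine Finset.sum_congr rfl fun q _ => ?_
    have hq : ((g * q.out : G) : G ⧸ H) = g • q := by
      conv_rhs => rw [← QuotientGroup.out_eq' q]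
      rfl
    have hdec := out_mul_subgroupPart (H := H) (g * q.out)
    rw [hq] at hdec
    rw [MulAction.toPerm_apply, ← measure_preimage_smul (μ := ν) (subgroupPart H (g * q.out))
      ((fun x => (g • q).out • x) ⁻¹' E)]
    congr 1
    ext x
    simp only [Set.mem_preimage, Subgroup.smul_def, ← mul_smul, hdec]
  · rw [Measure.real, Measure.smul_apply, hσ _ hE, smul_eq_mul, ENNReal.toReal_mul,
      ENNReal.toReal_inv, ENNReal.toReal_natCast,
      ENNReal.toReal_sum fun q _ => measure_ne_top _ _, ← mul_assoc, mul_inv_cancel₀, one_mul]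
    · refine Finset.sum_congr rfl fun q _ => ?_
      rw [← Set.preimage_smul]
      rfl
    · exact_mod_cast Fintype.card_ne_zero (α := G ⧸ H)

end Average

/-! ### From H-subequivalence to G-subequivalence. -/

section CosetTranslates

variable {G X : Type*} [Group G] {H : Subgroup G} [Fintype (G ⧸ H)] [TopologicalSpace X]
  [MulAction G X] [ContinuousConstSMul G X]

/-- A closed set `R` that is subequivalent for `H` to the union of the coset translates of a part
of a castle is subequivalent for `G` to a part of the castle which has room for one copy for each
coset. -/
theorem Subequiv.of_coset_translates {k : ℕ} {S S₁ : Fin k → Finset G} {V : Fin k → Set X}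
    (hc : IsOpenCastle S V) {R : Set X}
    (φ : ∀ i, (G ⧸ H) × S₁ i → S i) (hφ : ∀ i, Function.Injective (φ i))
    (h : Subequiv H R (⋃ q : G ⧸ H, q.out⁻¹ • castleFootprint S₁ V)) {S' : Fin k → Finset G}
    (hS' : ∀ i p, (φ i p : G) ∈ S' i) :
    Subequiv G R (castleFootprint S' V) := by
  intro C hC hCR
  obtain ⟨m, U, g, hU, hcov, hdisj, hB⟩ := h C hC hCR
  let κ := Fin m × Σ i, (G ⧸ H) × S₁ i
  let W : κ → Set X := fun p => U p.1 ∩ (g p.1)⁻¹ • p.2.2.1.out⁻¹ • (p.2.2.2 : G) • V p.2.1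
  -- A piece sent by g into the q-translate of level s is brought back to the base and then raised
  -- to the level reserved for (q, s). Pieces for different pairs land in different levels; those
  -- for the same pair are already disjoint.
  let c : (Σ i, (G ⧸ H) × S₁ i) → G := fun r =>
    (φ r.1 r.2 : G) * ((r.2.2 : G)⁻¹ * r.2.1.out)
  let γ : κ → G := fun p => c p.2 * (g p.1 : G)
  have hsubset : ∀ p, γ p • W p ⊆ (φ p.2.1 p.2.2 : G) • V p.2.1 := by
    intro p
    refine (Set.smul_set_mono Set.inter_subset_right).trans (le_of_eq ?_)
    simp [γ, c, mul_smul, Subgroup.smul_def]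
  have hsubset' : ∀ p, γ p • W p ⊆ c p.2 • g p.1 • U p.1 := by
    intro p
    refine (Set.smul_set_mono Set.inter_subset_left).trans (le_of_eq ?_)
    simp [γ, mul_smul, Subgroup.smul_def]
  refine exists_fin_pieces W γ ?_ ?_ ?_ ?_
  · exact fun p => (hU _).inter ((((hc.isOpen _).smul _).smul _).smul _)
  · intro x hx
    obtain ⟨l, hl⟩ := Set.mem_iUnion.1 (hcov hx)
    obtain ⟨q, hq⟩ := Set.mem_iUnion.1 (hB l (Set.smul_mem_smul_set hl))
    rw [Set.mem_smul_set_iff_inv_smul_mem] at hq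
    obtain ⟨i, s, hs, hxs⟩ := mem_castleFootprint.1 hq
    refine Set.mem_iUnion.2 ⟨(l, ⟨i, (q, ⟨s, hs⟩)⟩), hl, ?_⟩
    rw [Set.mem_smul_set_iff_inv_smul_mem, Set.mem_smul_set_iff_inv_smul_mem, inv_inv,
      inv_inv]
    rwa [inv_inv] at hxs
  · rintro ⟨l, i, r⟩ ⟨l', i', r'⟩ hne
    refine Set.disjoint_left.2 fun y hy hy' => hne ?_
    obtain ⟨h1, h2⟩ := hc.castle.eq_of_mem (φ i r).2 (φ i' r').2 (hsubset _ hy) (hsubset _ hy')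
    obtain rfl : i = i' := h1
    obtain rfl : r = r' := hφ i (Subtype.ext h2)
    have hll : l = l' := by
      by_contra hll
      have hd := (Set.disjoint_smul_set (a := c ⟨i, r⟩)).2 (hdisj hll)
      exact Set.disjoint_left.1 hd (hsubset' _ hy) (hsubset' _ hy')
    rw [hll]
  · intro p x hx
    exact mem_castleFootprint.2 ⟨p.2.1, _, hS' _ _, hsubset p hx⟩

end CosetTranslates

/-! ### Almost finiteness of G and the conclusion. -/

section FiniteIndex

variable {G X : Type*} [Group G] {H : Subgroup G}
  [MetricSpace X] [CompactSpace X] [MulAction G X] [ContinuousConstSMul G X]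
  [MeasurableSpace X] [BorelSpace X]

/-- A point of C is visited at least once by its own orbit over all of G, that is with frequency at
least 1/|G|; the whole group has empty boundary and so is an admissible shape. -/
theorem eq_empty_of_measureReal_lt [Fintype G] {C : Set X} (hC : IsClosed C)
    (h : ∀ μ : Measure X, IsProbabilityMeasure μ → SMulInvariantMeasure G X μ →
      μ.real C < 1 / (Fintype.card G : ℝ)) : C = ∅ := by
  classical
  obtain ⟨K, δ, η, ε, hδ, hη, hε, hb⟩ := exists_uniform_frequency_bound (Γ := G) hC
    isClosed_empty (c := 1 / (Fintype.card G : ℝ)) (by simpa using h)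
  refine Set.eq_empty_of_forall_notMem fun x hx => ?_
  have hinv : IsInvariantShape K δ (Finset.univ : Finset G) := by
    have : kBoundary K (Finset.univ : Finset G) = ∅ := by
      simp [kBoundary]
    simp only [IsInvariantShape, this, Set.ncard_empty, Nat.cast_zero]
    positivity
  have h1 := hb Finset.univ Finset.univ_nonempty hinv x
  have h2 : 1 ≤ ((Finset.univ : Finset G).filter
      fun s => s • x ∈ Metric.cthickening η C).card :=
    Finset.card_pos.2 ⟨1, Finset.mem_filter.2 ⟨Finset.mem_univ _,
      Metric.self_subset_cthickening C (by simpa using hx)⟩⟩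
  have h2' : (1 : ℝ) ≤ (((Finset.univ : Finset G).filter
      fun s => s • x ∈ Metric.cthickening η C).card : ℝ) := by exact_mod_cast h2
  have h3 : (0 : ℝ) < Fintype.card G := by exact_mod_cast Fintype.card_pos (α := G)
  have h4 : (1 / (Fintype.card G : ℝ) - ε) * Fintype.card G = 1 - ε * Fintype.card G := by
    field_simp
  rw [Finset.card_univ, h4] at h1
  have h5 : 0 < ε * Fintype.card G := by positivity
  have h6 : (0 : ℝ) ≤ (((Finset.univ : Finset G).filter
      fun s => s • x ∈ Metric.cthickening η (∅ : Set X)).card : ℝ) := Nat.cast_nonneg _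
  linarith

variable [Fintype (G ⧸ H)]

theorem AlmostFinite.of_finiteIndex (hfree : ∀ (g : G) (x : X), g • x = x → g = 1)
    (h : AlmostFinite H X) : AlmostFinite G X := by
  classical
  intro N K δ hN hδ
  cases finite_or_infinite G with
  | inl hG =>
    have := Fintype.ofFinite G
    have hcard : (0 : ℝ) < Fintype.card G := by exact_mod_cast Fintype.card_pos (α := G)
    obtain ⟨k, S, V, hc, hinv, hdiam, hR⟩ := h.exists_castle_of_finiteIndex hfree K hδ
      (ε := 1 / (Fintype.card G : ℝ) / 2) (by positivity)
    refine ⟨k, S, V, hc, hinv, hdiam, fun _ => ∅, fun i => by simp, fun i => by simp; positivity,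
      ?_⟩
    have h0 : (castleFootprint S V)ᶜ = ∅ := eq_empty_of_measureReal_lt (G := G)
      (isOpen_castleFootprint S hc.isOpen).isClosed_compl
      fun μ hp hi => (hR μ hp hi).trans_lt (half_lt_self (by positivity))
    rw [h0]
    intro C _ hC
    exact ⟨0, fun _ => ∅, fun _ => 1, by simp, by simp [Set.subset_empty_iff.1 hC],
      fun i => i.elim0, fun i => i.elim0⟩
  | inr hG =>
    set n : ℕ := Fintype.card (G ⧸ H) with hn
    have hn0 : 0 < n := Fintype.card_pos
    have hn1 : (1 : ℝ) ≤ n := by exact_mod_cast hn0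
    have hN1 : (1 : ℝ) ≤ N := by exact_mod_cast hN
    -- Invariance under M forces nonempty shapes to have at least n N elements, so rounding |S|/(nN)
    -- down loses at most a factor 2. Finite groups lack such an M and are treated separately, with
    -- empty remainder.
    obtain ⟨M, hM, hMcard⟩ := Infinite.exists_superset_card_eq ({1} : Finset G) (n * N)
      (by rw [Finset.card_singleton]; exact Nat.mul_pos hn0 hN)
    -- Averaging costs a factor n on the remainder: n ε = 1/(4nN), which is below the lower bound (1
    -- - ε)/(2nN) for the measure of the chosen part since ε < 1/2.
    set ε : ℝ := 1 / (4 * n ^ 2 * N) with hε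
    have hε0 : 0 < ε := by positivity
    obtain ⟨k, S, V, hc, hinv, hdiam, hR⟩ := h.exists_castle_of_finiteIndex hfree (K ∪ M)
      (δ := min δ (1 / 2)) (ε := ε) (lt_min hδ one_half_pos) hε0
    have hlarge : ∀ i, (S i).Nonempty → n * N ≤ (S i).card := fun i hi => by
      rw [← hMcard]
      exact ((hinv i).mono Finset.subset_union_right (min_le_right _ _)).card_le
        one_half_lt_one hi (hM (by simp))
    choose S₁ hS₁ hS₁card using fun i =>
      Finset.exists_subset_card_eq (Nat.div_le_self (S i).card (n * N))
    have hle : ∀ i, n * (S₁ i).card * N ≤ (S i).card := fun i => by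
      rw [hS₁card]
      calc _ = (S i).card / (n * N) * (n * N) := by ring
        _ ≤ _ := Nat.div_mul_le_self _ _
    have hhalf : ∀ i, (S i).card / (2 * n * N : ℝ) ≤ (S₁ i).card := fun i => by
      rcases (S i).eq_empty_or_nonempty with hS | hS
      · simp [hS]
      rw [div_le_iff₀ (by positivity), hS₁card]
      have h1 := Nat.lt_div_mul_add (a := (S i).card) (Nat.mul_pos hn0 hN)
      have h2 : 1 ≤ (S i).card / (n * N) :=
        (Nat.one_le_div_iff (Nat.mul_pos hn0 hN)).2 (hlarge i hS)
      have h3 : (S i).card ≤ (S i).card / (n * N) * (2 * n * N) := by nlinarith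
      exact_mod_cast h3
    have hφ : ∀ i, ∃ φ : (G ⧸ H) × S₁ i → S i, Function.Injective φ := fun i => by
      obtain ⟨f⟩ := Function.Embedding.nonempty_of_card_le (α := (G ⧸ H) × S₁ i) (β := S i) (by
        simp only [Fintype.card_prod, Fintype.card_coe]
        exact (Nat.le_mul_of_pos_right _ hN).trans (hle i))
      exact ⟨f, f.injective⟩
    choose φ hφ using hφ
    refine ⟨k, S, V, hc, fun i => (hinv i).mono Finset.subset_union_left (min_le_left _ _),
      fun i s hs => (hdiam i s hs).trans_le (min_le_left _ _),
      fun i => Finset.univ.image fun p => (φ i p : G), fun i => ?_, fun i => ?_, ?_⟩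
    · intro g hg
      obtain ⟨p, -, rfl⟩ := Finset.mem_image.1 hg
      exact (φ i p).2
    · rw [le_div_iff₀ (by positivity)]
      have h1 : (Finset.univ.image fun p => (φ i p : G)).card ≤ n * (S₁ i).card := by
        refine Finset.card_image_le.trans (le_of_eq ?_)
        simp [hn]
      exact_mod_cast (Nat.mul_le_mul_right N h1).trans (hle i)
    · refine Subequiv.of_coset_translates hc φ hφ ?_
        (fun i p => Finset.mem_image_of_mem _ (Finset.mem_univ p))
      have hRc : IsClosed (castleFootprint S V)ᶜ :=
        (isOpen_castleFootprint S hc.isOpen).isClosed_compl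
      have hBo : IsOpen (castleFootprint S₁ V) := isOpen_castleFootprint S₁ hc.isOpen
      refine h.subequiv hRc (isOpen_iUnion fun q => hBo.smul _) fun ν hp hi => ?_
      obtain ⟨μ, hμp, hμi, hμ⟩ := exists_average (H := H) ν
      rw [← ENNReal.toReal_lt_toReal (measure_ne_top _ _) (measure_ne_top _ _)]
      change ν.real _ < ν.real _
      have hR1 : ν.real (castleFootprint S V)ᶜ ≤ n * μ.real (castleFootprint S V)ᶜ := by
        rw [hμ _ hRc.measurableSet]
        -- The representative of the trivial coset lies in H, so its term in the average is the
        -- ν-measure of the remainder itself.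
        have hmem : (((1 : G) : G ⧸ H)).out ∈ H := by
          have := QuotientGroup.eq.1 (QuotientGroup.out_eq' ((1 : G) : G ⧸ H)).symm
          simpa using this
        have h1 : ν.real (((1 : G) : G ⧸ H).out⁻¹ • (castleFootprint S V)ᶜ) =
            ν.real (castleFootprint S V)ᶜ :=
          measureReal_smul_set (μ := ν) (⟨_, H.inv_mem hmem⟩ : H) _
        rw [← h1]
        exact Finset.single_le_sum (f := fun q : G ⧸ H => ν.real (q.out⁻¹ • (castleFootprint S V)ᶜ))
          (fun _ _ => measureReal_nonneg) (Finset.mem_univ _)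
      have hB1 : μ.real (castleFootprint S₁ V) ≤
          ν.real (⋃ q : G ⧸ H, q.out⁻¹ • castleFootprint S₁ V) := by
        have h1 := hμ _ hBo.measurableSet
        have h2 : ∑ q : G ⧸ H, ν.real (q.out⁻¹ • castleFootprint S₁ V) ≤
            ∑ _q : G ⧸ H, ν.real (⋃ q : G ⧸ H, q.out⁻¹ • castleFootprint S₁ V) :=
          Finset.sum_le_sum fun q _ => measureReal_mono
            (Set.subset_iUnion (fun q : G ⧸ H => q.out⁻¹ • castleFootprint S₁ V) q)
        rw [← h1, Finset.sum_const, Finset.card_univ, nsmul_eq_mul, ← hn] at h2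
        exact le_of_mul_le_mul_left h2 (by positivity)
      have hB2 : (1 - ε) / (2 * n * N) ≤ μ.real (castleFootprint S₁ V) := by
        have h1 := (hc.mono hS₁).measureReal_castleFootprint (μ := μ)
        have h2 := hc.measureReal_castleFootprint (μ := μ)
        have h3 := probReal_add_probReal_compl (μ := μ)
          (isOpen_castleFootprint S hc.isOpen).measurableSet
        have h4 := hR μ hμp hμi
        calc (1 - ε) / (2 * n * N) ≤ μ.real (castleFootprint S V) / (2 * n * N) := by
              gcongr; linarith
          _ = ∑ i, (S i).card / (2 * n * N : ℝ) * μ.real (V i) := by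
              rw [h2, Finset.sum_div]
              exact Finset.sum_congr rfl fun i _ => by ring
          _ ≤ _ := by
              rw [h1]
              exact Finset.sum_le_sum fun i _ =>
                mul_le_mul_of_nonneg_right (hhalf i) measureReal_nonneg
      have hR2 : n * μ.real (castleFootprint S V)ᶜ ≤ 1 / (4 * n * N) := by
        calc _ ≤ n * ε := by gcongr; exact hR μ hμp hμi
          _ = _ := by rw [hε]; field_simp
      have hε1 : ε < 1 / 2 := by
        rw [hε, div_lt_div_iff₀ (by positivity) two_pos]
        nlinarith [mul_le_mul hn1 hn1 zero_le_one (by positivity)]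
      have hlt : (1 : ℝ) / (4 * n * N) < (1 - ε) / (2 * n * N) := by
        rw [div_lt_div_iff₀ (by positivity) (by positivity)]
        have : (0 : ℝ) < n * N := by positivity
        nlinarith
      linarith

end FiniteIndex

end Dyn

end

theorem mainTheorem3 {G X : Type*} [Group G] (H : Subgroup G) [Countable H] [H.FiniteIndex]
    [MetricSpace X] [CompactSpace X] [MeasurableSpace X] [BorelSpace X]
    [MulAction G X] [ContinuousConstSMul G X]
    (hfree : ∀ (g : G) (x : X), g • x = x → g = 1)
    (hH : Dyn.AlmostFinite H X) :
    Dyn.AlmostFinite G X ∧ Dyn.SmallBoundaryProperty G X ∧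
      Dyn.HasMComparison G X (H.index * (H.index + 1)) := by
  have := H.fintypeQuotientOfFiniteIndex
  have hG : Dyn.AlmostFinite G X := Dyn.AlmostFinite.of_finiteIndex hfree hH
  exact ⟨hG, hG.smallBoundaryProperty, hG.hasMComparison _⟩
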